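/- Let $\mathbf D$ be the open unit disk and $m$ the normalized Lebesgue (area) measure on it. Let $\mathcal B$ be the Bloch space of analytic $f:\mathbf D\to\mathbb C$ with $\|f\|_B=\sup_{z\in\mathbf D}(1-|z|^2)|f'(z)|<\infty$, normed by $|f(0)|+\|f\|_B$; let $\mathcal B_0\subset\mathcal B$ be the closed subspace of those $f$ with $\lim_{|z|\to1}(1-|z|^2)|f'(z)|=0$; and let $L^1_a$ be the Bergman space of analytic $f:\mathbf D\to\mathbb C$ with $\|f\|_1=\int_{\mathbf D}|f|\,dm<\infty$. Let $i:\mathcal B_0\to\mathcal B_0^{**}$ be the canonical inclusion. Define the bounded anti-linear maps $R_1:L^1_a\to\mathcal B_0^*$ and $R_2:\mathcal B\to(L^1_a)^*$ by $$R_1(g)(f)=\int_{\mathbf D}f\,\overline{g}\,(1-|z|^2)\,dm\quad(f\in\mathcal B_0),\qquad R_2(h)(f)=\int_{\mathbf D}f\,\overline{h}\,(1-|z|^2)\,dm\quad(f\in L^1_a),$$ and let $R_1^*:\mathcal B_0^{**}\to(L^1_a)^*$, $R_1^*(F)(g)=\overline{F(R_1(g))}$, be the anti-adjoint of $R_1$.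 Theorem. The map $R_2$ is injective and its range contains the range of $R_1^*$, so that $R=R_2^{-1}\circ R_1^*:\mathcal B_0^{**}\to\mathcal B$ is well defined, where $R_2^{-1}$ is the inverse of $R_2$ on its range. The map $R$ is a linear isomorphism of normed spaces (a linear bijection, continuous with continuous inverse), and $R(i(f))=f$ for every $f\in\mathcal B_0$. Moreover, for every sequence $(z_n)\subset\mathbf D$ with $|z_n|\to1$, the operators $T:\mathcal B_0\to c_0$, $T(f)=((1-|z_n|^2)f'(z_n))_n$, and $L:\mathcal B\to\ell_\infty$, $L(f)=((1-|z_n|^2)f'(z_n))_n$, satisfy $T^{**}=L\circ R$, where $T^{**}:\mathcal B_0^{**}\to c_0^{**}$ is the second adjoint of $T$ and $c_0^{**}$ is canonically identified with $\ell_\infty$. -/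

import Mathlib

open Filter Topology MeasureTheory
open scoped ENNReal ComplexConjugate

noncomputable section

/-- The open unit disk. -/
abbrev unitDisk : Set ℂ := Metric.ball 0 1

lemma weight_pos {z : ℂ} (hz : z ∈ unitDisk) : 0 < 1 - ‖z‖ ^ 2 := by
  have h : ‖z‖ < 1 := by simpa using hz
  nlinarith [norm_nonneg z]

/-- Normalized Lebesgue measure on the disk: `dm = dx dy / π`. -/
def diskMeasure : Measure ℂ := ENNReal.ofReal (Real.pi⁻¹) • volume.restrict unitDisk

/-- The analytic functions on the disk, each represented by its extension by `0` to `ℂ`, so that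
two elements are equal exactly when they agree on the disk. -/
def diskAnalytic : Submodule ℂ (ℂ → ℂ) where
  carrier := {f | DifferentiableOn ℂ f unitDisk ∧ ∀ z ∉ unitDisk, f z = 0}
  zero_mem' := ⟨differentiableOn_const 0, fun _ _ => rfl⟩
  add_mem' := fun hf hg => ⟨hf.1.add hg.1, fun z hz => by simp [hf.2 z hz, hg.2 z hz]⟩
  smul_mem' := fun c _ hf => ⟨hf.1.const_smul c, fun z hz => by simp [hf.2 z hz]⟩

lemma diskAnalytic.differentiableAt {f : ℂ → ℂ} (hf : f ∈ diskAnalytic) {z : ℂ}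
    (hz : z ∈ unitDisk) : DifferentiableAt ℂ f z :=
  hf.1.differentiableAt (Metric.isOpen_ball.mem_nhds hz)

lemma diskAnalytic.deriv_add {f g : ℂ → ℂ} (hf : f ∈ diskAnalytic) (hg : g ∈ diskAnalytic) {z : ℂ}
    (hz : z ∈ unitDisk) : deriv (f + g) z = deriv f z + deriv g z :=
  _root_.deriv_add (differentiableAt hf hz) (differentiableAt hg hz)

lemma diskAnalytic.deriv_smul {f : ℂ → ℂ} (hf : f ∈ diskAnalytic) (c : ℂ) {z : ℂ}
    (hz : z ∈ unitDisk) : deriv (c • f) z = c * deriv f z :=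
  deriv_const_smul c (differentiableAt hf hz)

/-! ### The Bloch space and the little Bloch space -/

/-- `f` belongs to the Bloch space: `f` is analytic on the disk and
`sup_{z ∈ D} (1 - |z|²) |f'(z)| < ∞`. -/
def blochSubmodule : Submodule ℂ (ℂ → ℂ) where
  carrier := {f | f ∈ diskAnalytic ∧
    BddAbove (Set.range fun z : unitDisk => (1 - ‖(z : ℂ)‖ ^ 2) * ‖deriv f z‖)}
  zero_mem' := ⟨diskAnalytic.zero_mem, ⟨0, by rintro _ ⟨z, rfl⟩; simp⟩⟩
  add_mem' := by
    rintro f g ⟨hf, M, hM⟩ ⟨hg, N, hN⟩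
    refine ⟨diskAnalytic.add_mem hf hg, M + N, ?_⟩
    rintro _ ⟨z, rfl⟩
    have h1 := hM ⟨z, rfl⟩
    have h2 := hN ⟨z, rfl⟩
    have h3 := weight_pos z.2
    simp only [diskAnalytic.deriv_add hf hg z.2] at *
    nlinarith [norm_add_le (deriv f z) (deriv g z)]
  smul_mem' := by
    rintro c f ⟨hf, M, hM⟩
    refine ⟨diskAnalytic.smul_mem c hf, ‖c‖ * M, ?_⟩
    rintro _ ⟨z, rfl⟩
    have h1 := hM ⟨z, rfl⟩
    simp only [diskAnalytic.deriv_smul hf c z.2, norm_mul] at *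
    nlinarith [norm_nonneg c]

/-- The Bloch space `B`. -/
def BlochSpace : Type := blochSubmodule

namespace BlochSpace

instance : AddCommGroup BlochSpace := inferInstanceAs (AddCommGroup blochSubmodule)
instance : Module ℂ BlochSpace := inferInstanceAs (Module ℂ blochSubmodule)
instance : FunLike BlochSpace ℂ ℂ where
  coe f := Subtype.val (p := fun f => f ∈ blochSubmodule) f
  coe_injective := Subtype.val_injective

lemma mem_analytic (f : BlochSpace) : (f : ℂ → ℂ) ∈ diskAnalytic := f.2.1

lemma coe_add (f g : BlochSpace) : ((f + g : BlochSpace) : ℂ → ℂ) = f + g := rfl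

lemma coe_smul (c : ℂ) (f : BlochSpace) : ((c • f : BlochSpace) : ℂ → ℂ) = c • (f : ℂ → ℂ) := rfl

lemma coe_zero : ((0 : BlochSpace) : ℂ → ℂ) = 0 := rfl

lemma coe_neg (f : BlochSpace) : ((-f : BlochSpace) : ℂ → ℂ) = -f := rfl

/-- The Bloch seminorm `sup_{z ∈ D} (1 - |z|²) |f'(z)|`. -/
def seminorm (f : BlochSpace) : ℝ := ⨆ z : unitDisk, (1 - ‖(z : ℂ)‖ ^ 2) * ‖deriv f z‖

lemma le_seminorm (f : BlochSpace) {z : ℂ} (hz : z ∈ unitDisk) :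
    (1 - ‖z‖ ^ 2) * ‖deriv f z‖ ≤ seminorm f :=
  le_ciSup f.2.2 (⟨z, hz⟩ : unitDisk)

instance : Nonempty unitDisk := ⟨⟨0, by simp⟩⟩

lemma seminorm_nonneg (f : BlochSpace) : 0 ≤ seminorm f :=
  le_trans (by simp) (le_seminorm f (z := 0) (by simp))

lemma seminorm_add_le (f g : BlochSpace) : seminorm (f + g) ≤ seminorm f + seminorm g := by
  refine ciSup_le fun z => ?_
  have h1 := le_seminorm f z.2
  have h2 := le_seminorm g z.2
  have h3 := weight_pos z.2
  rw [coe_add, diskAnalytic.deriv_add f.mem_analytic g.mem_analytic z.2]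
  nlinarith [norm_add_le (deriv f z) (deriv g z)]

lemma seminorm_smul_le (c : ℂ) (f : BlochSpace) : seminorm (c • f) ≤ ‖c‖ * seminorm f := by
  refine ciSup_le fun z => ?_
  have h1 := le_seminorm f z.2
  rw [coe_smul, diskAnalytic.deriv_smul f.mem_analytic c z.2, norm_mul]
  nlinarith [norm_nonneg c]

/-- Growth estimate for Bloch functions. -/
lemma growth (f : BlochSpace) {z : ℂ} (hz : z ∈ unitDisk) :
    (1 - ‖z‖ ^ 2) * ‖f z‖ ≤ ‖f 0‖ + seminorm f := by
  have hw := weight_pos hz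
  have hz1 : ‖z‖ < 1 := by simpa using hz
  have hs := seminorm_nonneg f
  have key : ‖f z - f 0‖ ≤ seminorm f / (1 - ‖z‖ ^ 2) * ‖z - 0‖ := by
    refine (convex_closedBall (0 : ℂ) ‖z‖).norm_image_sub_le_of_norm_deriv_le (𝕜 := ℂ)
      (fun w hw' => ?_) (fun w hw' => ?_) (by simp) (by simp)
    · refine diskAnalytic.differentiableAt f.mem_analytic ?_
      have : ‖w‖ ≤ ‖z‖ := by simpa using hw'
      simpa using this.trans_lt hz1
    · have hwz : ‖w‖ ≤ ‖z‖ := by simpa using hw'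
      have hwd : w ∈ unitDisk := by simpa using hwz.trans_lt hz1
      rw [le_div_iff₀ hw]
      have h1 := le_seminorm f hwd
      nlinarith [norm_nonneg (deriv f w), norm_nonneg w, mul_nonneg (norm_nonneg (deriv f w))
        (sub_nonneg.2 (pow_le_pow_left₀ (norm_nonneg w) hwz 2))]
  rw [sub_zero, div_mul_eq_mul_div, le_div_iff₀ hw] at key
  have h2 : ‖f z‖ ≤ ‖f z - f 0‖ + ‖f 0‖ := by
    simpa using norm_add_le (f z - f 0) (f 0)
  nlinarith [norm_nonneg (f 0), norm_nonneg z, norm_nonneg (f z - f 0), sq_nonneg ‖z‖,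
    mul_nonneg (norm_nonneg (f 0)) (sq_nonneg ‖z‖)]

/-- The norm `‖f‖ = |f(0)| + sup_{z ∈ D} (1 - |z|²) |f'(z)|`. -/
instance : NormedAddCommGroup BlochSpace :=
  AddGroupNorm.toNormedAddCommGroup
    { toFun := fun f => ‖f 0‖ + seminorm f
      map_zero' := by
        have h : seminorm 0 ≤ 0 := ciSup_le fun z => by
          rw [coe_zero]; simp
        have h' := seminorm_nonneg 0
        rw [coe_zero]
        simp [le_antisymm h h']
      add_le' := fun f g => by
        have h1 := seminorm_add_le f g
        have h2 := norm_add_le (f 0) (g 0)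
        rw [coe_add, Pi.add_apply]
        linarith
      neg' := fun f => by
        have h : (fun z => deriv (-f : ℂ → ℂ) z) = fun z => - deriv f z := by
          ext z; exact deriv.neg
        simp only [seminorm, coe_neg, Pi.neg_apply, norm_neg]
        congr 2
        ext z
        rw [congrFun h (z : ℂ), norm_neg]
      eq_zero_of_map_eq_zero' := fun f hf => by
        apply Subtype.ext
        funext z
        change f z = 0
        by_cases hz : z ∈ unitDisk
        · have h1 := growth f hz
          change ‖f 0‖ + seminorm f = 0 at hf
          rw [hf] at h1
          have h2 := weight_pos hz
          have : ‖f z‖ ≤ 0 := by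
            by_contra h
            push Not at h
            nlinarith [mul_pos h2 h]
          exact norm_le_zero_iff.1 this
        · exact f.mem_analytic.2 z hz }

lemma norm_def (f : BlochSpace) : ‖f‖ = ‖f 0‖ + seminorm f := rfl

instance : NormedSpace ℂ BlochSpace where
  norm_smul_le := fun c f => by
    have h := seminorm_smul_le c f
    rw [norm_def, norm_def, coe_smul, Pi.smul_apply, norm_smul]
    nlinarith

end BlochSpace

/-- Those `f ∈ B` with `(1 - |z|²) |f'(z)| → 0` as `|z| → 1⁻`. -/
def littleBlochSubmodule : Submodule ℂ BlochSpace where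
  carrier := {f | Tendsto (fun z : ℂ => (1 - ‖z‖ ^ 2) * ‖deriv f z‖)
    (comap (fun z : ℂ => ‖z‖) (𝓝[<] 1)) (𝓝 0)}
  zero_mem' := by
    have h : ∀ z : ℂ, deriv ((0 : BlochSpace) : ℂ → ℂ) z = 0 := fun z => by
      rw [BlochSpace.coe_zero]; simp
    change Tendsto (fun z : ℂ => (1 - ‖z‖ ^ 2) * ‖deriv ((0 : BlochSpace) : ℂ → ℂ) z‖) _ _
    simp only [h, norm_zero, mul_zero]
    exact tendsto_const_nhds
  add_mem' := by
    intro f g hf hg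
    have h := hf.add hg
    rw [add_zero] at h
    have hd : ∀ᶠ z : ℂ in comap (fun z : ℂ => ‖z‖) (𝓝[<] 1), z ∈ unitDisk := by
      refine mem_comap.2 ⟨Set.Iio 1, self_mem_nhdsWithin, fun z hz => by simpa using hz⟩
    refine squeeze_zero' ?_ ?_ h
    · filter_upwards [hd] with z hz
      exact mul_nonneg (weight_pos hz).le (norm_nonneg _)
    · filter_upwards [hd] with z hz
      have h3 := weight_pos hz
      rw [BlochSpace.coe_add, diskAnalytic.deriv_add f.mem_analytic g.mem_analytic hz]
      nlinarith [norm_add_le (deriv f z) (deriv g z)]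
  smul_mem' := by
    intro c f hf
    have h := hf.const_mul ‖c‖
    rw [mul_zero] at h
    have hd : ∀ᶠ z : ℂ in comap (fun z : ℂ => ‖z‖) (𝓝[<] 1), z ∈ unitDisk := by
      refine mem_comap.2 ⟨Set.Iio 1, self_mem_nhdsWithin, fun z hz => by simpa using hz⟩
    refine h.congr' ?_
    filter_upwards [hd] with z hz
    rw [BlochSpace.coe_smul, diskAnalytic.deriv_smul f.mem_analytic c hz, norm_mul]
    ring

/-- The little Bloch space `B₀`, with the norm of `B`. -/
def LittleBloch : Type := littleBlochSubmodule

namespace LittleBloch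

instance : NormedAddCommGroup LittleBloch :=
  inferInstanceAs (NormedAddCommGroup littleBlochSubmodule)
instance : NormedSpace ℂ LittleBloch := inferInstanceAs (NormedSpace ℂ littleBlochSubmodule)
instance : Coe LittleBloch BlochSpace := ⟨Subtype.val (p := fun f => f ∈ littleBlochSubmodule)⟩

lemma tendsto (f : LittleBloch) : Tendsto (fun z : ℂ => (1 - ‖z‖ ^ 2) * ‖deriv (f : BlochSpace) z‖)
    (comap (fun z : ℂ => ‖z‖) (𝓝[<] 1)) (𝓝 0) := f.2

lemma coe_add (f g : LittleBloch) : ((f + g : LittleBloch) : BlochSpace) = f + g := rfl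

lemma coe_smul (c : ℂ) (f : LittleBloch) :
    ((c • f : LittleBloch) : BlochSpace) = c • (f : BlochSpace) := rfl

lemma norm_coe (f : LittleBloch) : ‖(f : BlochSpace)‖ = ‖f‖ := rfl

end LittleBloch

/-! ### The Bergman space -/

/-- `f` belongs to the Bergman space: `f` is analytic on the disk and `∫_D |f| dm < ∞`. -/
def bergmanSubmodule : Submodule ℂ (ℂ → ℂ) where
  carrier := {f | f ∈ diskAnalytic ∧ Integrable f diskMeasure}
  zero_mem' := ⟨diskAnalytic.zero_mem, integrable_zero _ _ _⟩
  add_mem' := fun hf hg => ⟨diskAnalytic.add_mem hf.1 hg.1, hf.2.add hg.2⟩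
  smul_mem' := fun c _ hf => ⟨diskAnalytic.smul_mem c hf.1, hf.2.smul c⟩

/-- The Bergman space `L¹_a`. -/
def BergmanSpace : Type := bergmanSubmodule

namespace BergmanSpace

instance : AddCommGroup BergmanSpace := inferInstanceAs (AddCommGroup bergmanSubmodule)
instance : Module ℂ BergmanSpace := inferInstanceAs (Module ℂ bergmanSubmodule)
instance : FunLike BergmanSpace ℂ ℂ where
  coe f := Subtype.val (p := fun f => f ∈ bergmanSubmodule) f
  coe_injective := Subtype.val_injective

lemma mem_analytic (f : BergmanSpace) : (f : ℂ → ℂ) ∈ diskAnalytic := f.2.1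

lemma integrable (f : BergmanSpace) : Integrable (f : ℂ → ℂ) diskMeasure := f.2.2

lemma coe_add (f g : BergmanSpace) : ((f + g : BergmanSpace) : ℂ → ℂ) = f + g := rfl

lemma coe_smul (c : ℂ) (f : BergmanSpace) :
    ((c • f : BergmanSpace) : ℂ → ℂ) = c • (f : ℂ → ℂ) := rfl

lemma coe_zero : ((0 : BergmanSpace) : ℂ → ℂ) = 0 := rfl

lemma coe_neg (f : BergmanSpace) : ((-f : BergmanSpace) : ℂ → ℂ) = -f := rfl

lemma eq_zero_of_integral (f : BergmanSpace) (hf : ∫ z, ‖f z‖ ∂diskMeasure = 0) : f = 0 := by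
  have h1 : (fun z => ‖f z‖) =ᵐ[diskMeasure] 0 :=
    (integral_eq_zero_iff_of_nonneg (fun z => norm_nonneg _) f.integrable.norm).1 hf
  have h2 : (fun z => f z) =ᵐ[volume.restrict unitDisk] fun _ => 0 := by
    have h3 : ∀ᵐ z ∂volume.restrict unitDisk, ‖f z‖ = 0 :=
      (Measure.ae_ennreal_smul_measure_iff (by simp [Real.pi_pos])).1 h1
    filter_upwards [h3] with z hz
    simpa using hz
  have h4 : Set.EqOn f (fun _ => 0) unitDisk :=
    Measure.eqOn_open_of_ae_eq h2 Metric.isOpen_ball f.mem_analytic.1.continuousOn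
      continuousOn_const
  apply Subtype.ext
  funext z
  change f z = 0
  by_cases hz : z ∈ unitDisk
  · exact h4 hz
  · exact f.mem_analytic.2 z hz

/-- The norm `‖f‖₁ = ∫_D |f| dm`. -/
instance : NormedAddCommGroup BergmanSpace :=
  AddGroupNorm.toNormedAddCommGroup
    { toFun := fun f => ∫ z, ‖f z‖ ∂diskMeasure
      map_zero' := by simp [coe_zero]
      add_le' := fun f g => by
        rw [← integral_add f.integrable.norm g.integrable.norm]
        refine integral_mono (f + g).integrable.norm (f.integrable.norm.add g.integrable.norm)
          fun z => ?_
        exact norm_add_le (f z) (g z)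
      neg' := fun f => by simp [coe_neg]
      eq_zero_of_map_eq_zero' := eq_zero_of_integral }

lemma norm_def (f : BergmanSpace) : ‖f‖ = ∫ z, ‖f z‖ ∂diskMeasure := rfl

instance : NormedSpace ℂ BergmanSpace where
  norm_smul_le := fun c f => by
    simp [norm_def, coe_smul, integral_const_mul]

end BergmanSpace

/-! ### The weighted pairing, `R₁` and `R₂` -/

/-- `∫_D f(z) conj(g(z)) (1 - |z|²) dm(z)`. -/
def weightedPairing (f g : ℂ → ℂ) : ℂ :=
  ∫ z, f z * conj (g z) * ((1 - ‖z‖ ^ 2 : ℝ) : ℂ) ∂diskMeasure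

lemma ae_mem_unitDisk : ∀ᵐ z ∂diskMeasure, z ∈ unitDisk :=
  Measure.ae_smul_measure (ae_restrict_mem measurableSet_ball) _

lemma aestronglyMeasurable_of_analytic {f : ℂ → ℂ} (hf : f ∈ diskAnalytic) :
    AEStronglyMeasurable f diskMeasure :=
  (hf.1.continuousOn.aestronglyMeasurable measurableSet_ball).smul_measure _

lemma norm_pairing_integrand (f : BlochSpace) (g : BergmanSpace) : ∀ᵐ z ∂diskMeasure,
    ‖f z * conj (g z) * ((1 - ‖z‖ ^ 2 : ℝ) : ℂ)‖ ≤ ‖f‖ * ‖g z‖ := by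
  filter_upwards [ae_mem_unitDisk] with z hz
  have h1 := f.growth hz
  have h2 := weight_pos hz
  rw [← BlochSpace.norm_def] at h1
  rw [norm_mul, norm_mul, RCLike.norm_conj, Complex.norm_real, Real.norm_of_nonneg h2.le]
  nlinarith [norm_nonneg (g z)]

lemma integrable_pairing (f : BlochSpace) (g : BergmanSpace) :
    Integrable (fun z => f z * conj (g z) * ((1 - ‖z‖ ^ 2 : ℝ) : ℂ)) diskMeasure := by
  refine (g.integrable.norm.const_mul ‖f‖).mono' ?_ (norm_pairing_integrand f g)
  refine ((aestronglyMeasurable_of_analytic f.mem_analytic).mul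
    (RCLike.continuous_conj.comp_aestronglyMeasurable
      (aestronglyMeasurable_of_analytic g.mem_analytic))).mul ?_
  exact Continuous.aestronglyMeasurable (by fun_prop)

lemma integrable_pairing' (f : BergmanSpace) (h : BlochSpace) :
    Integrable (fun z => f z * conj (h z) * ((1 - ‖z‖ ^ 2 : ℝ) : ℂ)) diskMeasure := by
  have := Complex.conjCLE.toContinuousLinearMap.integrable_comp (integrable_pairing h f)
  refine this.congr (Eventually.of_forall fun z => ?_)
  simp only [ContinuousLinearEquiv.coe_coe, Complex.conjCLE_apply, map_mul, Complex.conj_conj,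
    Complex.conj_ofReal]
  ring

lemma norm_pairing_le (f : BlochSpace) (g : BergmanSpace) :
    ‖weightedPairing f g‖ ≤ ‖f‖ * ‖g‖ := by
  rw [BergmanSpace.norm_def, ← integral_const_mul]
  exact norm_integral_le_of_norm_le (g.integrable.norm.const_mul ‖f‖) (norm_pairing_integrand f g)

lemma weightedPairing_conj (f g : ℂ → ℂ) : weightedPairing g f = conj (weightedPairing f g) := by
  rw [weightedPairing, weightedPairing, ← integral_conj]
  congr 1
  ext z
  simp only [map_mul, Complex.conj_conj, Complex.conj_ofReal]
  ring

/-- `R₁ : L¹_a → B₀*`, `R₁(g)(f) = ∫_D f conj(g) (1 - |z|²) dm`, anti-linear and bounded. -/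
def blochR1 : BergmanSpace →SL[starRingEnd ℂ] StrongDual ℂ LittleBloch :=
  (LinearMap.mk₂'ₛₗ (starRingEnd ℂ) (RingHom.id ℂ)
    (fun (g : BergmanSpace) (f : LittleBloch) => weightedPairing (f : BlochSpace) g)
    (fun g₁ g₂ f => by
      rw [weightedPairing, weightedPairing, weightedPairing,
        ← integral_add (integrable_pairing f g₁) (integrable_pairing f g₂)]
      congr 1; ext z
      simp only [BergmanSpace.coe_add, Pi.add_apply, map_add]; ring)
    (fun c g f => by
      rw [weightedPairing, weightedPairing, smul_eq_mul, ← integral_const_mul]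
      congr 1; ext z
      simp only [BergmanSpace.coe_smul, Pi.smul_apply, smul_eq_mul, map_mul]; ring)
    (fun g f₁ f₂ => by
      rw [weightedPairing, weightedPairing, weightedPairing,
        ← integral_add (integrable_pairing f₁ g) (integrable_pairing f₂ g)]
      congr 1; ext z
      simp only [LittleBloch.coe_add, BlochSpace.coe_add, Pi.add_apply]; ring)
    (fun c g f => by
      rw [weightedPairing, weightedPairing, smul_eq_mul, ← integral_const_mul]
      congr 1; ext z
      simp only [LittleBloch.coe_smul, BlochSpace.coe_smul, Pi.smul_apply, smul_eq_mul,
        RingHom.id_apply]; ring)).mkContinuous₂ 1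
    (fun g f => by
      have := norm_pairing_le (f : BlochSpace) g
      rw [LittleBloch.norm_coe] at this
      simpa [mul_comm] using this)

lemma blochR1_apply (g : BergmanSpace) (f : LittleBloch) :
    blochR1 g f = weightedPairing (f : BlochSpace) g := rfl

/-- `R₂ : B → (L¹_a)*`, `R₂(h)(f) = ∫_D f conj(h) (1 - |z|²) dm`, anti-linear and bounded. -/
def blochR2 : BlochSpace →SL[starRingEnd ℂ] StrongDual ℂ BergmanSpace :=
  (LinearMap.mk₂'ₛₗ (starRingEnd ℂ) (RingHom.id ℂ)
    (fun (h : BlochSpace) (f : BergmanSpace) => weightedPairing f h)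
    (fun h₁ h₂ f => by
      rw [weightedPairing, weightedPairing, weightedPairing,
        ← integral_add (integrable_pairing' f h₁) (integrable_pairing' f h₂)]
      congr 1; ext z
      simp only [BlochSpace.coe_add, Pi.add_apply, map_add]; ring)
    (fun c h f => by
      rw [weightedPairing, weightedPairing, smul_eq_mul, ← integral_const_mul]
      congr 1; ext z
      simp only [BlochSpace.coe_smul, Pi.smul_apply, smul_eq_mul, map_mul]; ring)
    (fun h f₁ f₂ => by
      rw [weightedPairing, weightedPairing, weightedPairing,
        ← integral_add (integrable_pairing' f₁ h) (integrable_pairing' f₂ h)]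
      congr 1; ext z
      simp only [BergmanSpace.coe_add, Pi.add_apply]; ring)
    (fun c h f => by
      rw [weightedPairing, weightedPairing, smul_eq_mul, ← integral_const_mul]
      congr 1; ext z
      simp only [BergmanSpace.coe_smul, Pi.smul_apply, smul_eq_mul, RingHom.id_apply];
      ring)).mkContinuous₂ 1
    (fun h f => by
      have := norm_pairing_le h f
      rw [weightedPairing_conj, RCLike.norm_conj] at this
      simpa using this)

lemma blochR2_apply (h : BlochSpace) (f : BergmanSpace) :
    blochR2 h f = weightedPairing f h := rfl

/-- The anti-adjoint `S* : Y* → X*` of a bounded anti-linear map `S : X → Y`,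
`S*(y*)(x) = conj (y* (S x))`. -/
def antiAdjoint {X Y : Type*} [NormedAddCommGroup X] [NormedSpace ℂ X] [NormedAddCommGroup Y]
    [NormedSpace ℂ Y] (S : X →SL[starRingEnd ℂ] Y) :
    StrongDual ℂ Y →SL[starRingEnd ℂ] StrongDual ℂ X :=
  (LinearMap.mk₂'ₛₗ (starRingEnd ℂ) (RingHom.id ℂ)
    (fun (y : StrongDual ℂ Y) (x : X) => conj (y (S x)))
    (fun y₁ y₂ x => by simp)
    (fun c y x => by simp)
    (fun y x₁ x₂ => by simp)
    (fun c y x => by simp)).mkContinuous₂ ‖S‖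
    (fun y x => by
      calc ‖conj (y (S x))‖ = ‖y (S x)‖ := RCLike.norm_conj _
        _ ≤ ‖y‖ * ‖S x‖ := y.le_opNorm _
        _ ≤ ‖y‖ * (‖S‖ * ‖x‖) := by gcongr; exact S.le_opNorm _
        _ = ‖S‖ * ‖y‖ * ‖x‖ := by ring)

lemma antiAdjoint_apply {X Y : Type*} [NormedAddCommGroup X] [NormedSpace ℂ X]
    [NormedAddCommGroup Y] [NormedSpace ℂ Y] (S : X →SL[starRingEnd ℂ] Y) (y : StrongDual ℂ Y)
    (x : X) : antiAdjoint S y x = conj (y (S x)) := rfl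

/-- `R = R₂⁻¹ ∘ R₁* : B₀** → B`. Here `R₂⁻¹` is the inverse of `R₂` on its range. -/
def blochR (F : StrongDual ℂ (StrongDual ℂ LittleBloch)) : BlochSpace :=
  Function.invFun blochR2
    (antiAdjoint (X := BergmanSpace) (Y := StrongDual ℂ LittleBloch) blochR1 F)

/-! ### The interpolation operators -/

/-- The space `ℓ∞` of bounded complex sequences, with the supremum norm. -/
abbrev LInfty : Type := lp (fun _ : ℕ => ℂ) ∞

/-- The closed subspace of `ℓ∞` of the sequences that tend to `0`. -/
def cZeroSubmodule : Submodule ℂ LInfty where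
  carrier := {b | Tendsto (fun n => b n) atTop (𝓝 0)}
  zero_mem' := tendsto_const_nhds
  add_mem' := fun ha hb => by simpa using ha.add hb
  smul_mem' := fun c _ hb => by simpa using hb.const_mul c

/-- The space `c₀` of complex sequences that tend to `0`, with the supremum norm. -/
def CZero : Type := cZeroSubmodule

instance : NormedAddCommGroup CZero := inferInstanceAs (NormedAddCommGroup cZeroSubmodule)
instance : NormedSpace ℂ CZero := inferInstanceAs (NormedSpace ℂ cZeroSubmodule)
instance : FunLike CZero ℕ ℂ where
  coe b := fun n => Subtype.val (p := fun b => b ∈ cZeroSubmodule) b n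
  coe_injective := fun _ _ h => Subtype.ext (lp.ext h)

lemma CZero.tendsto (b : CZero) : Tendsto b atTop (𝓝 0) := b.2

lemma CZero.sub_apply (a b : CZero) (n : ℕ) : (a - b) n = a n - b n := rfl

lemma CZero.norm_le {f : CZero} {M : ℝ} (hM : 0 ≤ M) : ‖f‖ ≤ M ↔ ∀ n, ‖f n‖ ≤ M :=
  ⟨fun h n => (lp.norm_apply_le_norm ENNReal.top_ne_zero
      (Subtype.val (p := fun b => b ∈ cZeroSubmodule) f) n).trans h,
    fun h => lp.norm_le_of_forall_le hM h⟩

/-- `L : B → ℓ∞`, `L(f) = ((1 - |zₙ|²) f'(zₙ))ₙ`. -/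
def interpL (z : ℕ → ℂ) (hz : ∀ n, z n ∈ unitDisk) : BlochSpace →L[ℂ] LInfty :=
  LinearMap.mkContinuous
    { toFun := fun f =>
        ⟨fun n => ((1 - ‖z n‖ ^ 2 : ℝ) : ℂ) * deriv f (z n), memℓp_infty ⟨f.seminorm, by
          rintro _ ⟨n, rfl⟩
          have := f.le_seminorm (hz n)
          simpa only [norm_mul, Complex.norm_real,
            Real.norm_of_nonneg (weight_pos (hz n)).le] using this⟩⟩
      map_add' := fun f g => by
        ext n
        change ((1 - ‖z n‖ ^ 2 : ℝ) : ℂ) * deriv (f + g : BlochSpace) (z n) =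
          ((1 - ‖z n‖ ^ 2 : ℝ) : ℂ) * deriv f (z n) + ((1 - ‖z n‖ ^ 2 : ℝ) : ℂ) * deriv g (z n)
        rw [BlochSpace.coe_add, diskAnalytic.deriv_add f.mem_analytic g.mem_analytic (hz n), mul_add]
      map_smul' := fun c f => by
        ext n
        change ((1 - ‖z n‖ ^ 2 : ℝ) : ℂ) * deriv (c • f : BlochSpace) (z n) =
          c * (((1 - ‖z n‖ ^ 2 : ℝ) : ℂ) * deriv f (z n))
        rw [BlochSpace.coe_smul, diskAnalytic.deriv_smul f.mem_analytic c (hz n)]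
        ring }
    1 (fun f => by
      refine lp.norm_le_of_forall_le (by positivity) fun n => ?_
      have h1 := f.le_seminorm (hz n)
      change ‖((1 - ‖z n‖ ^ 2 : ℝ) : ℂ) * deriv f (z n)‖ ≤ _
      rw [norm_mul, Complex.norm_real, Real.norm_of_nonneg (weight_pos (hz n)).le, one_mul,
        BlochSpace.norm_def]
      linarith [norm_nonneg (f 0)])

lemma interpL_apply (z : ℕ → ℂ) (hz : ∀ n, z n ∈ unitDisk) (f : BlochSpace) (n : ℕ) :
    interpL z hz f n = ((1 - ‖z n‖ ^ 2 : ℝ) : ℂ) * deriv f (z n) := rfl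

lemma interpL_mem_CZero (z : ℕ → ℂ) (hz : ∀ n, z n ∈ unitDisk)
    (hlim : Tendsto (fun n => ‖z n‖) atTop (𝓝 1)) (f : LittleBloch) :
    interpL z hz (f : BlochSpace) ∈ cZeroSubmodule := by
  change Tendsto (fun n => ((1 - ‖z n‖ ^ 2 : ℝ) : ℂ) * deriv (f : BlochSpace) (z n)) atTop (𝓝 0)
  rw [tendsto_zero_iff_norm_tendsto_zero]
  have h1 : Tendsto z atTop (comap (fun z : ℂ => ‖z‖) (𝓝[<] 1)) := by
    refine tendsto_comap_iff.2 (tendsto_nhdsWithin_iff.2 ⟨hlim, ?_⟩)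
    exact Eventually.of_forall fun n => by simpa using hz n
  refine (Tendsto.comp f.tendsto h1).congr fun n => ?_
  simp only [Function.comp_apply, norm_mul, Complex.norm_real,
    Real.norm_of_nonneg (weight_pos (hz n)).le]

/-- `T : B₀ → c₀`, `T(f) = ((1 - |zₙ|²) f'(zₙ))ₙ`, where `|zₙ| → 1`. -/
def interpT (z : ℕ → ℂ) (hz : ∀ n, z n ∈ unitDisk) (hlim : Tendsto (fun n => ‖z n‖) atTop (𝓝 1)) :
    LittleBloch →L[ℂ] CZero :=
  LinearMap.mkContinuous
    { toFun := fun f => ⟨interpL z hz (f : BlochSpace), interpL_mem_CZero z hz hlim f⟩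
      map_add' := fun f g => Subtype.ext ((interpL z hz).map_add f g)
      map_smul' := fun c f => Subtype.ext ((interpL z hz).map_smul c (f : BlochSpace)) }
    ‖interpL z hz‖ (fun f => (interpL z hz).le_opNorm (f : BlochSpace))

lemma interpT_apply (z : ℕ → ℂ) (hz : ∀ n, z n ∈ unitDisk)
    (hlim : Tendsto (fun n => ‖z n‖) atTop (𝓝 1)) (f : LittleBloch) (n : ℕ) :
    interpT z hz hlim f n =
      ((1 - ‖z n‖ ^ 2 : ℝ) : ℂ) * deriv (f : BlochSpace) (z n) := rfl

/-- The Banach space adjoint `S* : Y* → X*` of a bounded linear map `S : X → Y`,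
`S*(y*) = y* ∘ S`. -/
def banachAdjoint {X Y : Type*} [NormedAddCommGroup X] [NormedSpace ℂ X] [NormedAddCommGroup Y]
    [NormedSpace ℂ Y] (S : X →L[ℂ] Y) : StrongDual ℂ Y →L[ℂ] StrongDual ℂ X :=
  ContinuousLinearMap.precomp ℂ S

/-! ### The canonical identification of `c₀**` with `ℓ∞` -/

/-- The unit vectors of `c₀`. -/
def c0Single (k : ℕ) : CZero :=
  ⟨lp.single (E := fun _ => ℂ) ∞ k 1, by
    refine tendsto_const_nhds.congr' ?_
    filter_upwards [eventually_gt_atTop k] with n hn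
    exact (lp.single_apply_ne (E := fun _ => ℂ) ∞ k 1 hn.ne').symm⟩

lemma c0Single_apply (k n : ℕ) : c0Single k n = if n = k then 1 else 0 := by
  change lp.single (E := fun _ => ℂ) ∞ k 1 n = _
  rw [lp.coeFn_single, Pi.single_apply]

/-- The coordinate functionals of `c₀`. -/
def c0Coord (k : ℕ) : StrongDual ℂ CZero :=
  LinearMap.mkContinuous
    { toFun := fun f => f k
      map_add' := fun _ _ => rfl
      map_smul' := fun _ _ => rfl } 1
    (fun f => by
      rw [one_mul]
      exact (CZero.norm_le (norm_nonneg f)).1 le_rfl k)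

lemma c0Coord_apply (k : ℕ) (f : CZero) : c0Coord k f = f k := rfl

lemma norm_c0Coord_le (k : ℕ) : ‖c0Coord k‖ ≤ 1 :=
  LinearMap.mkContinuous_norm_le _ zero_le_one _

lemma c0_sum_apply (s : Finset ℕ) (c : ℕ → ℂ) (n : ℕ) :
    (∑ k ∈ s, c k • c0Single k) n = if n ∈ s then c n else 0 := by
  rw [← c0Coord_apply, map_sum]
  simp [c0Coord_apply, c0Single_apply]

lemma c0_hasSum (f : CZero) : HasSum (fun k => f k • c0Single k) f := by
  rw [HasSum, SummationFilter.unconditional_filter, Metric.tendsto_atTop]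
  intro ε hε
  have h : Tendsto (fun n => f n) atTop (𝓝 0) := f.tendsto
  rw [← Nat.cofinite_eq_atTop] at h
  have hfin : {n | ¬ ‖f n‖ < ε / 2}.Finite := by
    have := (Metric.tendsto_nhds.1 h) (ε / 2) (half_pos hε)
    simpa using this
  refine ⟨hfin.toFinset, fun s hs => ?_⟩
  rw [dist_eq_norm]
  refine lt_of_le_of_lt ((CZero.norm_le (half_pos hε).le).2 fun n => ?_) (half_lt_self hε)
  rw [CZero.sub_apply, c0_sum_apply]
  by_cases hn : n ∈ s
  · simp [hn, (half_pos hε).le]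
  · have h2 : n ∉ hfin.toFinset := fun h' => hn (hs h')
    have h3 : ‖f n‖ < ε / 2 := by simpa using h2
    simpa [hn] using h3.le

lemma c0Dual_sum_le (y : StrongDual ℂ CZero) (s : Finset ℕ) :
    ∑ k ∈ s, ‖y (c0Single k)‖ ≤ ‖y‖ := by
  set c : ℕ → ℂ := fun k => conj (y (c0Single k)) / ‖y (c0Single k)‖ with hc
  have hx : ‖∑ k ∈ s, c k • c0Single k‖ ≤ 1 := by
    refine (CZero.norm_le zero_le_one).2 fun n => ?_
    rw [c0_sum_apply]
    split_ifs
    · rw [hc]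
      simp only [norm_div, RCLike.norm_conj, Complex.norm_real, norm_norm]
      exact div_self_le_one _
    · simp
  have hy : y (∑ k ∈ s, c k • c0Single k) = ((∑ k ∈ s, ‖y (c0Single k)‖ : ℝ) : ℂ) := by
    rw [map_sum, Complex.ofReal_sum]
    refine Finset.sum_congr rfl fun k _ => ?_
    rw [map_smul, smul_eq_mul, hc]
    by_cases h0 : y (c0Single k) = 0
    · simp [h0]
    · have : ((‖y (c0Single k)‖ : ℝ) : ℂ) ≠ 0 := by simpa using h0
      field_simp
      rw [Complex.conj_mul']
  have h := y.le_opNorm_of_le hx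
  rw [hy, Complex.norm_real, mul_one, Real.norm_of_nonneg (by positivity)] at h
  exact h

lemma c0Dual_summable (y : StrongDual ℂ CZero) : Summable fun k => ‖y (c0Single k)‖ :=
  summable_of_sum_le (fun _ => norm_nonneg _) (c0Dual_sum_le y)

lemma c0Dual_summable_mul (y : StrongDual ℂ CZero) (b : LInfty) :
    Summable fun k => ‖y (c0Single k) * b k‖ := by
  refine ((c0Dual_summable y).mul_right ‖b‖).of_nonneg_of_le (fun _ => norm_nonneg _) fun k => ?_
  rw [norm_mul]
  gcongr
  exact lp.norm_apply_le_norm ENNReal.top_ne_zero b k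

lemma c0Dual_hasSum (y : StrongDual ℂ CZero) :
    HasSum (fun k => y (c0Single k) • c0Coord k) y := by
  have hs : Summable fun k => y (c0Single k) • c0Coord k := by
    refine Summable.of_norm_bounded (c0Dual_summable y) fun k => ?_
    rw [norm_smul]
    exact mul_le_of_le_one_right (norm_nonneg _) (norm_c0Coord_le k)
  obtain ⟨y', hy'⟩ := hs
  have h : y' = y := by
    refine ContinuousLinearMap.ext fun f => ?_
    have h1 : HasSum (fun k => y (c0Single k) * f k) (y' f) :=
      hy'.mapL (ContinuousLinearMap.apply ℂ ℂ f)
    have h2 : HasSum (fun k => y (f k • c0Single k)) (y f) := (c0_hasSum f).mapL y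
    refine h1.unique ?_
    convert h2 using 2 with k
    rw [map_smul, smul_eq_mul, mul_comm]
  rwa [h] at hy'

/-- The functional on `c₀*` given by a bounded sequence `b`: `y ↦ ∑ₖ y(eₖ) bₖ`. -/
def linftyToBidual (b : LInfty) : StrongDual ℂ (StrongDual ℂ CZero) :=
  LinearMap.mkContinuous
    { toFun := fun y => ∑' k, y (c0Single k) * b k
      map_add' := fun y₁ y₂ => by
        rw [← (c0Dual_summable_mul y₁ b).of_norm.tsum_add (c0Dual_summable_mul y₂ b).of_norm]
        simp [add_mul]
      map_smul' := fun c y => by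
        simp [mul_assoc, tsum_mul_left] }
    ‖b‖ (fun y => by
      change ‖∑' k, y (c0Single k) * b k‖ ≤ _
      refine (norm_tsum_le_tsum_norm (c0Dual_summable_mul y b)).trans ?_
      refine ((c0Dual_summable_mul y b).tsum_le_tsum (fun k => ?_)
        ((c0Dual_summable y).mul_right ‖b‖)).trans ?_
      · rw [norm_mul]
        gcongr
        exact lp.norm_apply_le_norm ENNReal.top_ne_zero b k
      · rw [tsum_mul_right, mul_comm]
        gcongr
        exact (c0Dual_summable y).tsum_le_of_sum_le (c0Dual_sum_le y))

lemma norm_linftyToBidual_le (b : LInfty) : ‖linftyToBidual b‖ ≤ ‖b‖ :=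
  LinearMap.mkContinuous_norm_le _ (norm_nonneg b) _

/-- The sequence `(Φ(k-th coordinate functional))ₖ` of `Φ ∈ c₀**`. -/
def bidualToLinfty (Φ : StrongDual ℂ (StrongDual ℂ CZero)) : LInfty :=
  ⟨fun k => Φ (c0Coord k), memℓp_infty ⟨‖Φ‖, by
    rintro _ ⟨k, rfl⟩
    simpa using Φ.le_opNorm_of_le (norm_c0Coord_le k)⟩⟩

lemma linftyToBidual_bidualToLinfty (Φ : StrongDual ℂ (StrongDual ℂ CZero)) :
    linftyToBidual (bidualToLinfty Φ) = Φ := by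
  ext y
  change ∑' k, y (c0Single k) * Φ (c0Coord k) = Φ y
  rw [← ((c0Dual_hasSum y).mapL Φ).tsum_eq]
  simp

/-- The canonical isometric identification `c₀** = ℓ∞`, `Φ ↦ (Φ(k-th coordinate functional))ₖ`. -/
def c0Bidual : StrongDual ℂ (StrongDual ℂ CZero) ≃ₗᵢ[ℂ] LInfty where
  toFun := bidualToLinfty
  map_add' _ _ := rfl
  map_smul' _ _ := rfl
  invFun := linftyToBidual
  left_inv := linftyToBidual_bidualToLinfty
  right_inv b := by
    ext k
    change ∑' j, c0Coord k (c0Single j) * b j = b k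
    rw [tsum_eq_single k]
    · simp [c0Coord_apply, c0Single_apply]
    · intro j hj
      simp [c0Coord_apply, c0Single_apply, hj.symm]
  norm_map' Φ := by
    refine le_antisymm (lp.norm_le_of_forall_le (norm_nonneg Φ) fun k => ?_) ?_
    · change ‖Φ (c0Coord k)‖ ≤ ‖Φ‖
      simpa using Φ.le_opNorm_of_le (norm_c0Coord_le k)
    · have h := norm_linftyToBidual_le (bidualToLinfty Φ)
      rwa [linftyToBidual_bidualToLinfty] at h

lemma c0Bidual_apply (Φ : StrongDual ℂ (StrongDual ℂ CZero)) (k : ℕ) :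
    c0Bidual Φ k = Φ (c0Coord k) := rfl

end

/-! The point evaluations `δ_z` form an analytic map from the disk into `B₀*`, and `R` turns out to
be `F ↦ (z ↦ F(δ_z))`, which is `bidualToBloch`. Since `(1 - |z|²)‖δ_z‖ ≤ 1` and `(1 - |z|²)‖δ'_z‖ ≤
1`, this function is Bloch with norm at most `2‖F‖`. The functional `R₁(g)` is the Bochner integral
of `conj(g) (1 - |z|²) δ_z`; moving `F` under the integral gives `R₂ (bidualToBloch F) = R₁* F`
(`blochR2_bidualToBloch`). Together with injectivity of `R₂` (`blochR2_injective`) this identifies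
`R`.

Surjectivity (`exists_bidualToBloch_eq`): the dilations of a Bloch function `h` lie in `B₀`, have
norm at most `‖h‖` and converge to `h` pointwise, so any weak* cluster point of them in `B₀**` is
sent to `h`.

Injectivity is the deeper half: an `F` that kills every `δ_z` must be zero. The key is that a
functional `φ` on `B₀` is nearly unchanged, in norm, by composition with a dilation of radius close
to 1 (`LittleBloch.exists_dilation_close`). This rests on a gliding-hump argument
(`LittleBloch.exists_norm_apply_le`): a nearly extremal function for `φ` has small weighted
derivative near the circle, so a function living near the circle can be added at almost no cost in
norm, and `φ` must be small on it. The dilated functional is in turn a norm limit of combinations of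
Taylor coefficient functionals, which `F` kills.

Finally, the `n`-th coordinate of `T` is the functional `(1 - |zₙ|²) δ'_{zₙ}`, and `F(δ'_z)` is the
derivative of `R F` at `z`. -/

/-! ### Growth and derivative bounds in the disk. -/

lemma mul_mem_unitDisk {r : ℝ} (hr0 : 0 ≤ r) (hr1 : r ≤ 1) {z : ℂ} (hz : z ∈ unitDisk) :
    (r : ℂ) * z ∈ unitDisk := by
  have h : ‖z‖ < 1 := by simpa using hz
  have : ‖(r : ℂ) * z‖ < 1 := by
    rw [norm_mul, Complex.norm_real, Real.norm_of_nonneg hr0]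
    nlinarith [norm_nonneg z]
  simpa using this

lemma mem_unitDisk_of_norm_le {ρ : ℝ} (hρ : ρ < 1) {z : ℂ} (hz : ‖z‖ ≤ ρ) : z ∈ unitDisk := by
  simpa using hz.trans_lt hρ

namespace BlochSpace

@[ext] lemma ext_disk {f g : BlochSpace} (h : ∀ z ∈ unitDisk, f z = g z) : f = g := by
  refine DFunLike.ext _ _ fun z => ?_
  by_cases hz : z ∈ unitDisk
  · exact h z hz
  · rw [f.mem_analytic.2 z hz, g.mem_analytic.2 z hz]

lemma seminorm_le_norm (f : BlochSpace) : f.seminorm ≤ ‖f‖ := by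
  rw [norm_def]; linarith [norm_nonneg (f 0)]

lemma norm_deriv_le (f : BlochSpace) {ρ : ℝ} (hρ : ρ < 1) {z : ℂ} (hz : ‖z‖ ≤ ρ) :
    ‖deriv f z‖ ≤ f.seminorm / (1 - ρ ^ 2) := by
  have h0 : 0 ≤ ρ := (norm_nonneg z).trans hz
  rw [le_div_iff₀ (by nlinarith)]
  have h1 := f.le_seminorm (mem_unitDisk_of_norm_le hρ hz)
  nlinarith [norm_nonneg (deriv f z), mul_nonneg (norm_nonneg (deriv f z))
    (sub_nonneg.2 (pow_le_pow_left₀ (norm_nonneg z) hz 2))]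

lemma norm_sub_le (f : BlochSpace) {ρ : ℝ} (hρ : ρ < 1) {z w : ℂ} (hz : ‖z‖ ≤ ρ)
    (hw : ‖w‖ ≤ ρ) : ‖f z - f w‖ ≤ f.seminorm / (1 - ρ ^ 2) * ‖z - w‖ := by
  refine (convex_closedBall (0 : ℂ) ρ).norm_image_sub_le_of_norm_deriv_le (𝕜 := ℂ)
    (fun x hx => ?_) (fun x hx => ?_) (by simpa using hw) (by simpa using hz)
  · exact diskAnalytic.differentiableAt f.mem_analytic
      (mem_unitDisk_of_norm_le hρ (by simpa using hx))
  · exact f.norm_deriv_le hρ (by simpa using hx)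

/-- Bloch functions are `O((1 - |z|)^(-1/2))`. -/
lemma exists_growth_sqrt (f : BlochSpace) :
    ∃ K, ∀ z ∈ unitDisk, ‖f z‖ * √(1 - ‖z‖) ≤ K := by
  refine ⟨‖f 0‖ + 2 * f.seminorm, fun z hz => ?_⟩
  have hz1 : ‖z‖ < 1 := by simpa using hz
  have hs := f.seminorm_nonneg
  have hmem : ∀ t ∈ Set.Icc (0 : ℝ) 1, (t : ℂ) * z ∈ unitDisk :=
    fun t ht => mul_mem_unitDisk ht.1 ht.2 hz
  have hd : ∀ t ∈ Set.Icc (0 : ℝ) 1,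
      HasDerivAt (fun t : ℝ => f (t * z) - f 0) (deriv f (t * z) * z) t := fun t ht => by
    have h1 := (diskAnalytic.differentiableAt f.mem_analytic (hmem t ht)).hasDerivAt
    have h2 : HasDerivAt (fun s : ℂ => s * z) z (t : ℂ) := by
      simpa using (hasDerivAt_id (t : ℂ)).mul_const z
    exact ((h1.comp (t : ℂ) h2).comp_ofReal).sub_const _
  have hu : ∀ t ∈ Set.Icc (0 : ℝ) 1, 0 < 1 - t * ‖z‖ := fun t ht => by
    nlinarith [norm_nonneg z, ht.1, ht.2]
  -- The majorant `2s(1 - t|z|)^(-1/2)` has derivative `s|z|(1 - t|z|)^(-3/2)`, which dominates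
  -- `|z||f'(tz)|` because `(1 - u)^(3/2) ≤ 1 - u²` for `0 ≤ u < 1`. The true growth is logarithmic;
  -- the exponent 1/2 is chosen so that a product of two such bounds is absorbed by the weight.
  have hB : ∀ t ∈ Set.Icc (0 : ℝ) 1, HasDerivAt (fun t : ℝ => 2 * f.seminorm * (√(1 - t * ‖z‖))⁻¹)
      (f.seminorm * ‖z‖ / (√(1 - t * ‖z‖) * (1 - t * ‖z‖))) t := fun t ht => by
    have h1 : HasDerivAt (fun t : ℝ => 1 - t * ‖z‖) (-‖z‖) t := by
      simpa using ((hasDerivAt_id t).mul_const ‖z‖).const_sub 1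
    have h2 := ((h1.sqrt (hu t ht).ne').inv (Real.sqrt_pos.2 (hu t ht)).ne').const_mul
      (2 * f.seminorm)
    refine h2.congr_deriv ?_
    have h3 := Real.sqrt_pos.2 (hu t ht)
    rw [Real.sq_sqrt (hu t ht).le]
    have h4 := (hu t ht).ne'
    field_simp
  have key := image_norm_le_of_norm_deriv_right_le_deriv_boundary' (a := 0) (b := 1)
    (f := fun t : ℝ => f (t * z) - f 0) (fun t ht => (hd t ht).continuousAt.continuousWithinAt)
    (fun t ht => (hd t (Set.Ico_subset_Icc_self ht)).hasDerivWithinAt)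
    (by simpa using hs) (fun t ht => (hB t ht).continuousAt.continuousWithinAt)
    (fun t ht => (hB t (Set.Ico_subset_Icc_self ht)).hasDerivWithinAt) (fun t ht => by
      have ht' := Set.Ico_subset_Icc_self ht
      have h1 := f.le_seminorm (hmem t ht')
      have h2 := hu t ht'
      have h3 := Real.sqrt_pos.2 h2
      have h4 : √(1 - t * ‖z‖) ≤ 1 :=
        Real.sqrt_le_one.2 (by nlinarith [norm_nonneg z, ht.1, mul_nonneg ht.1 (norm_nonneg z)])
      have h5 : ‖(t : ℂ) * z‖ = t * ‖z‖ := by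
        rw [norm_mul, Complex.norm_real, Real.norm_of_nonneg ht.1]
      rw [h5] at h1
      have h6 : 0 ≤ t * ‖z‖ := mul_nonneg ht.1 (norm_nonneg z)
      rw [norm_mul, le_div_iff₀ (by positivity)]
      have h7 : √(1 - t * ‖z‖) * (1 - t * ‖z‖) ≤ 1 - (t * ‖z‖) ^ 2 := by nlinarith
      have h8 := (mul_le_mul_of_nonneg_right h7 (norm_nonneg (deriv f (t * z)))).trans h1
      nlinarith [norm_nonneg z])
    (Set.right_mem_Icc.2 zero_le_one)
  have h1 : 0 < √(1 - ‖z‖) := Real.sqrt_pos.2 (by linarith)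
  simp only [Complex.ofReal_one, one_mul] at key
  rw [← div_eq_mul_inv, le_div_iff₀ h1] at key
  have h2 : ‖f z‖ ≤ ‖f z - f 0‖ + ‖f 0‖ := by simpa using norm_add_le (f z - f 0) (f 0)
  have h3 : √(1 - ‖z‖) ≤ 1 := Real.sqrt_le_one.2 (by linarith [norm_nonneg z])
  nlinarith [norm_nonneg (f 0)]

end BlochSpace

/-- Cauchy's estimate on the circle of radius `R / 2`, since nothing is assumed on the boundary of
the ball; hence the factor 2. -/
lemma norm_deriv_le_of_norm_le_ball {g : ℂ → ℂ} {c : ℂ} {R M : ℝ} (hR : 0 < R)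
    (hg : DifferentiableOn ℂ g (Metric.ball c R)) (hM : ∀ z ∈ Metric.ball c R, ‖g z‖ ≤ M) :
    ‖deriv g c‖ ≤ 2 * M / R := by
  have hsub : Metric.closedBall c (R / 2) ⊆ Metric.ball c R :=
    Metric.closedBall_subset_ball (half_lt_self hR)
  have h := Complex.norm_deriv_le_of_forall_mem_sphere_norm_le (half_pos hR)
    ((hg.mono (Metric.closure_ball_subset_closedBall.trans hsub)).diffContOnCl)
    (fun z hz => hM z (hsub (Metric.sphere_subset_closedBall hz)))
  calc _ ≤ _ := h
    _ = _ := by field_simp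

/-! ### Monomials and dilations in the little Bloch space. -/

namespace LittleBloch

lemma ext_disk {f g : LittleBloch} (h : ∀ z ∈ unitDisk, (f : BlochSpace) z = (g : BlochSpace) z) :
    f = g :=
  Subtype.ext (BlochSpace.ext_disk h)

/-- A function with bounded derivative on the disk, as an element of the little Bloch space. -/
noncomputable def ofBoundedDeriv (g : ℂ → ℂ) (hg : DifferentiableOn ℂ g unitDisk)
    (hb : ∃ C, ∀ z ∈ unitDisk, ‖deriv g z‖ ≤ C) : LittleBloch :=
  have hd : ∀ z ∈ unitDisk, deriv (unitDisk.indicator g) z = deriv g z := fun z hz =>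
    Filter.EventuallyEq.deriv_eq (Set.eqOn_indicator.eventuallyEq_of_mem
      (Metric.isOpen_ball.mem_nhds hz))
  ⟨⟨unitDisk.indicator g, ⟨hg.congr fun z hz => Set.indicator_of_mem hz g,
    fun z hz => Set.indicator_of_notMem hz g⟩, by
      obtain ⟨C, hC⟩ := hb
      refine ⟨C, ?_⟩
      rintro _ ⟨z, rfl⟩
      have h1 := hC z z.2
      have h2 := weight_pos z.2
      simp only [hd z z.2]
      nlinarith [norm_nonneg (deriv g z), sq_nonneg ‖(z : ℂ)‖]⟩, by
    obtain ⟨C, hC⟩ := hb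
    have hmem : ∀ᶠ z : ℂ in comap (fun z : ℂ => ‖z‖) (𝓝[<] 1), z ∈ unitDisk :=
      mem_comap.2 ⟨Set.Iio 1, self_mem_nhdsWithin, fun z hz => by simpa using hz⟩
    have hlim : Tendsto (fun z : ℂ => (1 - ‖z‖ ^ 2) * C)
        (comap (fun z : ℂ => ‖z‖) (𝓝[<] 1)) (𝓝 0) := by
      have h : Tendsto (fun t : ℝ => (1 - t ^ 2) * C) (𝓝[<] 1) (𝓝 0) := by
        have : ContinuousAt (fun t : ℝ => (1 - t ^ 2) * C) 1 := by fun_prop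
        simpa [ContinuousAt] using this.tendsto.mono_left nhdsWithin_le_nhds
      exact h.comp tendsto_comap
    refine squeeze_zero' ?_ ?_ hlim
    · filter_upwards [hmem] with z hz
      exact mul_nonneg (weight_pos hz).le (norm_nonneg _)
    · filter_upwards [hmem] with z hz
      change (1 - ‖z‖ ^ 2) * ‖deriv (unitDisk.indicator g) z‖ ≤ _
      rw [hd z hz]
      exact mul_le_mul_of_nonneg_left (hC z hz) (weight_pos hz).le⟩

lemma ofBoundedDeriv_apply {g : ℂ → ℂ} (hg : DifferentiableOn ℂ g unitDisk)
    (hb : ∃ C, ∀ z ∈ unitDisk, ‖deriv g z‖ ≤ C) {z : ℂ} (hz : z ∈ unitDisk) :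
    (ofBoundedDeriv g hg hb : BlochSpace) z = g z :=
  Set.indicator_of_mem hz g

/-- The monomial `zⁿ`. -/
noncomputable def monomial (n : ℕ) : LittleBloch :=
  ofBoundedDeriv (fun z => z ^ n) (by fun_prop) ⟨n, fun z hz => by
    have h : ‖z‖ < 1 := by simpa using hz
    simp only [differentiableAt_fun_id, deriv_fun_pow, deriv_id'', mul_one, norm_mul, norm_pow,
      Complex.norm_natCast]
    exact mul_le_of_le_one_right n.cast_nonneg (pow_le_one₀ (norm_nonneg z) h.le)⟩

lemma monomial_apply (n : ℕ) {z : ℂ} (hz : z ∈ unitDisk) : (monomial n : BlochSpace) z = z ^ n :=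
  ofBoundedDeriv_apply _ _ hz

end LittleBloch

namespace BlochSpace

lemma hasDerivAt_dilation (h : BlochSpace) {r : ℝ} (hr0 : 0 ≤ r) (hr1 : r ≤ 1) {z : ℂ}
    (hz : z ∈ unitDisk) :
    HasDerivAt (fun z => h (r * z)) (r * deriv h (r * z)) z := by
  have h1 := (diskAnalytic.differentiableAt h.mem_analytic
    (mul_mem_unitDisk hr0 hr1 hz)).hasDerivAt
  have h2 : HasDerivAt (fun z : ℂ => (r : ℂ) * z) r z := by
    simpa using (hasDerivAt_id z).const_mul (r : ℂ)
  rw [mul_comm]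
  exact h1.comp z h2

/-- The dilation `z ↦ h (r z)`, for `0 ≤ r < 1`. -/
noncomputable def dilation (h : BlochSpace) {r : ℝ} (hr0 : 0 ≤ r) (hr1 : r < 1) : LittleBloch :=
  LittleBloch.ofBoundedDeriv (fun z => h (r * z))
    (fun z hz => (h.hasDerivAt_dilation hr0 hr1.le hz).differentiableAt.differentiableWithinAt)
    ⟨h.seminorm / (1 - r ^ 2), fun z hz => by
      have hz1 : ‖z‖ < 1 := by simpa using hz
      have hn : ‖(r : ℂ) * z‖ ≤ r := by
        rw [norm_mul, Complex.norm_real, Real.norm_of_nonneg hr0]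
        exact mul_le_of_le_one_right hr0 hz1.le
      rw [(h.hasDerivAt_dilation hr0 hr1.le hz).deriv, norm_mul, Complex.norm_real,
        Real.norm_of_nonneg hr0]
      have := h.norm_deriv_le hr1 hn
      nlinarith [norm_nonneg (deriv h (r * z))]⟩

lemma dilation_apply (h : BlochSpace) {r : ℝ} (hr0 : 0 ≤ r) (hr1 : r < 1) {z : ℂ}
    (hz : z ∈ unitDisk) : (h.dilation hr0 hr1 : BlochSpace) z = h (r * z) :=
  LittleBloch.ofBoundedDeriv_apply _ _ hz

lemma deriv_dilation (h : BlochSpace) {r : ℝ} (hr0 : 0 ≤ r) (hr1 : r < 1) {z : ℂ}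
    (hz : z ∈ unitDisk) : deriv (h.dilation hr0 hr1 : BlochSpace) z = r * deriv h (r * z) := by
  rw [← (h.hasDerivAt_dilation hr0 hr1.le hz).deriv]
  refine Filter.EventuallyEq.deriv_eq ?_
  filter_upwards [Metric.isOpen_ball.mem_nhds hz] with w hw
  exact h.dilation_apply hr0 hr1 hw

/-- The chain rule factor `r` is harmless because `r(1 - |z|²) ≤ 1 - |rz|²`. A constant of exactly 1
is what later bounds the inverse of `R` by 1. -/
lemma seminorm_dilation_le (h : BlochSpace) {r : ℝ} (hr0 : 0 ≤ r) (hr1 : r < 1) :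
    (h.dilation hr0 hr1 : BlochSpace).seminorm ≤ h.seminorm := by
  refine ciSup_le fun z => ?_
  have h1 := h.le_seminorm (mul_mem_unitDisk hr0 hr1.le z.2)
  have h2 := weight_pos z.2
  rw [h.deriv_dilation hr0 hr1 z.2]
  rw [norm_mul, Complex.norm_real, Real.norm_of_nonneg hr0] at h1 ⊢
  refine le_trans ?_ h1
  have h3 : (1 - ‖(z : ℂ)‖ ^ 2) * r ≤ 1 - (r * ‖(z : ℂ)‖) ^ 2 := by
    nlinarith [sq_nonneg ‖(z : ℂ)‖, mul_nonneg hr0 (sq_nonneg ‖(z : ℂ)‖)]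
  nlinarith [norm_nonneg (deriv h (r * z))]

lemma norm_dilation_le (h : BlochSpace) {r : ℝ} (hr0 : 0 ≤ r) (hr1 : r < 1) :
    ‖h.dilation hr0 hr1‖ ≤ ‖h‖ := by
  rw [← LittleBloch.norm_coe, norm_def, norm_def, h.dilation_apply hr0 hr1 (by simp), mul_zero]
  linarith [h.seminorm_dilation_le hr0 hr1]

end BlochSpace

/-! ### Point evaluations as an analytic map into the dual. -/

namespace LittleBloch

/-- Evaluation at `z`, as a functional on the little Bloch space. -/
noncomputable def pointEval (z : ℂ) : StrongDual ℂ LittleBloch :=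
  LinearMap.mkContinuous
    { toFun := fun f => (f : BlochSpace) z
      map_add' := fun _ _ => rfl
      map_smul' := fun _ _ => rfl } |(1 - ‖z‖ ^ 2)⁻¹|
    (fun f => by
      change ‖(f : BlochSpace) z‖ ≤ _
      by_cases hz : z ∈ unitDisk
      · have h1 := (f : BlochSpace).growth hz
        have h2 := weight_pos hz
        rw [← BlochSpace.norm_def, norm_coe] at h1
        rw [abs_of_pos (inv_pos.2 h2), inv_mul_eq_div, le_div_iff₀ h2, mul_comm]
        exact h1
      · rw [(f : BlochSpace).mem_analytic.2 z hz, norm_zero]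
        positivity)

lemma pointEval_apply (z : ℂ) (f : LittleBloch) : pointEval z f = (f : BlochSpace) z := rfl

lemma norm_pointEval_le {z : ℂ} (hz : z ∈ unitDisk) : (1 - ‖z‖ ^ 2) * ‖pointEval z‖ ≤ 1 := by
  have h2 := weight_pos hz
  have h : ‖pointEval z‖ ≤ (1 - ‖z‖ ^ 2)⁻¹ :=
    (LinearMap.mkContinuous_norm_le _ (abs_nonneg _) _).trans_eq (abs_of_pos (inv_pos.2 h2))
  calc _ ≤ (1 - ‖z‖ ^ 2) * (1 - ‖z‖ ^ 2)⁻¹ := by gcongr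
    _ = 1 := mul_inv_cancel₀ h2.ne'

lemma pointEval_of_notMem {z : ℂ} (hz : z ∉ unitDisk) : pointEval z = 0 :=
  ContinuousLinearMap.ext fun f => (f : BlochSpace).mem_analytic.2 z hz

/-- On a smaller disk the mean value inequality is uniform over the unit ball of `B₀`, so the
evaluations are Lipschitz in the dual norm. This makes their vector-valued Cauchy integral
meaningful. -/
lemma continuousOn_pointEval_closedBall {ρ : ℝ} (hρ0 : 0 ≤ ρ) (hρ : ρ < 1) :
    ContinuousOn pointEval (Metric.closedBall 0 ρ) := by
  have hw : 0 < 1 - ρ ^ 2 := by nlinarith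
  refine (LipschitzOnWith.of_dist_le_mul (K := ((1 - ρ ^ 2)⁻¹).toNNReal)
    fun z hz w hw' => ?_).continuousOn
  rw [dist_eq_norm, dist_eq_norm, Real.coe_toNNReal _ (inv_nonneg.2 hw.le)]
  refine ContinuousLinearMap.opNorm_le_bound _ (by positivity) fun f => ?_
  have h1 := (f : BlochSpace).norm_sub_le hρ (z := z) (w := w) (by simpa using hz)
    (by simpa using hw')
  have h2 := (f : BlochSpace).seminorm_le_norm
  rw [norm_coe] at h2
  refine h1.trans ?_
  rw [div_mul_eq_mul_div, div_le_iff₀ hw]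
  field_simp
  nlinarith [norm_nonneg (z - w)]

/-- `z ↦ pointEval z` is given by its Cauchy power series on every smaller disk. -/
lemma hasFPowerSeriesOnBall_pointEval {R : NNReal} (hR0 : 0 < R) (hR1 : R < 1) :
    HasFPowerSeriesOnBall pointEval (cauchyPowerSeries pointEval 0 R) 0 R := by
  have hR1' : (R : ℝ) < 1 := by exact_mod_cast hR1
  have hcont := continuousOn_pointEval_closedBall R.2 hR1'
  have hint : CircleIntegrable pointEval 0 R :=
    (hcont.mono Metric.sphere_subset_closedBall).circleIntegrable R.2
  -- The Cauchy integral has this power series for any circle integrable boundary values. That it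
  -- reproduces `pointEval` is tested on each `f`, where it is the scalar Cauchy formula.
  refine (hasFPowerSeriesOn_cauchy_integral hint hR0).congr fun w hw => ?_
  have hw' : w ∈ Metric.ball (0 : ℂ) R := by rwa [Metric.eball_coe] at hw
  refine ContinuousLinearMap.ext fun f => ?_
  have hfd : DifferentiableOn ℂ (f : BlochSpace) unitDisk := (f : BlochSpace).mem_analytic.1
  have hsub : Metric.closedBall (0 : ℂ) R ⊆ unitDisk := Metric.closedBall_subset_ball hR1'
  have h := ((hfd.mono (Metric.closure_ball_subset_closedBall.trans
    hsub)).diffContOnCl).two_pi_i_inv_smul_circleIntegral_sub_inv_smul hw'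
  rw [pointEval_apply, ← h, smul_apply]
  congr 1
  have hint2 : CircleIntegrable (fun z => (z - w)⁻¹ • pointEval z) 0 R := by
    refine ContinuousOn.circleIntegrable R.2 (ContinuousOn.fun_smul (fun z hz => ?_)
      (hcont.mono Metric.sphere_subset_closedBall))
    refine ContinuousAt.continuousWithinAt (ContinuousAt.inv₀ (by fun_prop) (sub_ne_zero.2 ?_))
    rintro rfl
    simp only [mem_sphere_iff_norm, sub_zero, mem_ball_zero_iff] at hz hw'
    exact hw'.ne hz
  exact (((ContinuousLinearMap.apply ℂ ℂ f).intervalIntegral_comp_comm hint2.out).symm)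

lemma differentiableAt_pointEval {z : ℂ} (hz : z ∈ unitDisk) :
    DifferentiableAt ℂ pointEval z := by
  have hz1 : ‖z‖ < 1 := by simpa using hz
  obtain ⟨R, hR, hR1⟩ := exists_between hz1
  lift R to NNReal using (norm_nonneg z).trans hR.le
  have hR0 : 0 < R := by exact_mod_cast (norm_nonneg z).trans_lt hR
  have hp := hasFPowerSeriesOnBall_pointEval hR0 (by exact_mod_cast hR1)
  refine hp.differentiableOn.differentiableAt (Metric.isOpen_eball.mem_nhds ?_)
  rw [Metric.eball_coe]
  simpa using hR

lemma deriv_pointEval_apply {z : ℂ} (hz : z ∈ unitDisk) (f : LittleBloch) :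
    deriv pointEval z f = deriv (f : BlochSpace) z :=
  (((ContinuousLinearMap.apply ℂ ℂ f).hasFDerivAt.comp_hasDerivAt z
    (differentiableAt_pointEval hz).hasDerivAt).deriv).symm

lemma norm_deriv_pointEval_le {z : ℂ} (hz : z ∈ unitDisk) :
    (1 - ‖z‖ ^ 2) * ‖deriv pointEval z‖ ≤ 1 := by
  have h2 := weight_pos hz
  rw [mul_comm, ← le_div_iff₀ h2]
  refine ContinuousLinearMap.opNorm_le_bound _ (by positivity) fun f => ?_
  rw [deriv_pointEval_apply hz, div_mul_eq_mul_div, le_div_iff₀ h2, one_mul, mul_comm]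
  exact ((f : BlochSpace).le_seminorm hz).trans (f : BlochSpace).seminorm_le_norm

lemma aestronglyMeasurable_pointEval : AEStronglyMeasurable pointEval diskMeasure :=
  (ContinuousOn.aestronglyMeasurable
    (fun _ hz => (differentiableAt_pointEval hz).continuousAt.continuousWithinAt)
    measurableSet_ball).smul_measure _

end LittleBloch

/-! ### The candidate for `R` and its relation to `R₁*` and `R₂`. -/

open LittleBloch

lemma hasDerivAt_bidual_pointEval (F : StrongDual ℂ (StrongDual ℂ LittleBloch)) {z : ℂ}
    (hz : z ∈ unitDisk) :
    HasDerivAt (fun w => F (pointEval w)) (F (deriv pointEval z)) z :=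
  F.hasFDerivAt.comp_hasDerivAt z (differentiableAt_pointEval hz).hasDerivAt

lemma norm_bidual_deriv_pointEval_le (F : StrongDual ℂ (StrongDual ℂ LittleBloch)) {z : ℂ}
    (hz : z ∈ unitDisk) : (1 - ‖z‖ ^ 2) * ‖F (deriv pointEval z)‖ ≤ ‖F‖ := by
  have h1 := F.le_opNorm (deriv pointEval z)
  have h2 := norm_deriv_pointEval_le hz
  have h3 := weight_pos hz
  nlinarith [norm_nonneg F]

/-- The Bloch function `z ↦ F(δ_z)` attached to `F ∈ B₀**`. -/
noncomputable def bidualToBloch :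
    StrongDual ℂ (StrongDual ℂ LittleBloch) →ₗ[ℂ] BlochSpace where
  toFun F := ⟨fun z => F (pointEval z), ⟨fun z hz =>
      (hasDerivAt_bidual_pointEval F hz).differentiableAt.differentiableWithinAt,
      fun z hz => by simp only [pointEval_of_notMem hz, map_zero]⟩, ‖F‖, by
    rintro _ ⟨z, rfl⟩
    simp only [(hasDerivAt_bidual_pointEval F z.2).deriv]
    exact norm_bidual_deriv_pointEval_le F z.2⟩
  map_add' _ _ := rfl
  map_smul' _ _ := rfl

lemma bidualToBloch_apply (F : StrongDual ℂ (StrongDual ℂ LittleBloch)) (z : ℂ) :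
    bidualToBloch F z = F (pointEval z) := rfl

lemma deriv_bidualToBloch (F : StrongDual ℂ (StrongDual ℂ LittleBloch)) {z : ℂ}
    (hz : z ∈ unitDisk) : deriv (bidualToBloch F) z = F (deriv pointEval z) :=
  (hasDerivAt_bidual_pointEval F hz).deriv

/-- The value at the origin and the seminorm each contribute at most `‖F‖`. -/
lemma norm_bidualToBloch_le (F : StrongDual ℂ (StrongDual ℂ LittleBloch)) :
    ‖bidualToBloch F‖ ≤ 2 * ‖F‖ := by
  have h1 : (bidualToBloch F).seminorm ≤ ‖F‖ := ciSup_le fun z => by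
    rw [deriv_bidualToBloch F z.2]
    exact norm_bidual_deriv_pointEval_le F z.2
  have h2 : ‖bidualToBloch F 0‖ ≤ ‖F‖ := by
    have h3 : ‖pointEval 0‖ ≤ 1 := by simpa using norm_pointEval_le (z := 0) (by simp)
    exact (F.le_opNorm_of_le h3).trans_eq (mul_one _)
  rw [BlochSpace.norm_def]
  linarith

lemma bidualToBloch_inclusion (f : LittleBloch) :
    bidualToBloch (NormedSpace.inclusionInDoubleDual ℂ LittleBloch f) = f := rfl

/-- The weight compensates the growth of `‖δ_z‖`, leaving `|g|` as an integrable majorant. -/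
lemma integrable_conj_smul_pointEval (g : BergmanSpace) :
    Integrable (fun z => (conj (g z) * ((1 - ‖z‖ ^ 2 : ℝ) : ℂ)) • pointEval z) diskMeasure := by
  refine g.integrable.norm.mono' ?_ ?_
  · refine ((RCLike.continuous_conj.comp_aestronglyMeasurable
      (aestronglyMeasurable_of_analytic g.mem_analytic)).mul
      (Continuous.aestronglyMeasurable (by fun_prop))).smul aestronglyMeasurable_pointEval
  · filter_upwards [ae_mem_unitDisk] with z hz
    have h1 := norm_pointEval_le hz
    rw [norm_smul, norm_mul, RCLike.norm_conj, Complex.norm_real,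
      Real.norm_of_nonneg (weight_pos hz).le, mul_assoc]
    exact mul_le_of_le_one_right (norm_nonneg _) h1

lemma blochR1_eq_integral (g : BergmanSpace) :
    blochR1 g = ∫ z, (conj (g z) * ((1 - ‖z‖ ^ 2 : ℝ) : ℂ)) • pointEval z ∂diskMeasure := by
  refine ContinuousLinearMap.ext fun f => ?_
  rw [ContinuousLinearMap.integral_apply (integrable_conj_smul_pointEval g), blochR1_apply,
    weightedPairing]
  refine integral_congr_ae (Eventually.of_forall fun z => ?_)
  simp only [smul_apply, pointEval_apply, smul_eq_mul]
  ring

/-- An arbitrary `F` commutes with the Bochner integral representing `R₁(g)`; this is why a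
norm-convergent integral in `B₀*`, and not just its values on each `f`, was needed. -/
lemma blochR2_bidualToBloch (F : StrongDual ℂ (StrongDual ℂ LittleBloch)) :
    blochR2 (bidualToBloch F) =
      antiAdjoint (X := BergmanSpace) (Y := StrongDual ℂ LittleBloch) blochR1 F := by
  refine ContinuousLinearMap.ext fun g => ?_
  rw [antiAdjoint_apply, blochR2_apply, weightedPairing_conj, blochR1_eq_integral,
    ← F.integral_comp_comm (integrable_conj_smul_pointEval g), weightedPairing]
  congr 1
  refine integral_congr_ae (Eventually.of_forall fun z => ?_)
  simp only [map_smul, smul_eq_mul, bidualToBloch_apply]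
  ring

/-! ### Injectivity of `R₂`. -/

instance : IsFiniteMeasure diskMeasure :=
  ⟨by simp [diskMeasure, ENNReal.mul_lt_top_iff]⟩

/-- The dilation `z ↦ h (r z)` of a Bloch function, as an element of the Bergman space. -/
noncomputable def BlochSpace.bergmanDilation (h : BlochSpace) {r : ℝ} (hr0 : 0 ≤ r) (hr1 : r < 1) :
    BergmanSpace :=
  ⟨(h.dilation hr0 hr1 : BlochSpace), (h.dilation hr0 hr1 : BlochSpace).mem_analytic, by
    refine Integrable.of_bound (aestronglyMeasurable_of_analytic
      (h.dilation hr0 hr1 : BlochSpace).mem_analytic) (‖h‖ / (1 - r ^ 2)) ?_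
    filter_upwards [ae_mem_unitDisk] with z hz
    have hz1 : ‖z‖ < 1 := by simpa using hz
    have h1 := h.growth (mul_mem_unitDisk hr0 hr1.le hz)
    rw [h.dilation_apply hr0 hr1 hz, le_div_iff₀ (by nlinarith), BlochSpace.norm_def]
    refine le_trans ?_ h1
    rw [norm_mul, Complex.norm_real, Real.norm_of_nonneg hr0, mul_comm]
    gcongr
    exact mul_le_of_le_one_right hr0 hz1.le⟩

lemma BlochSpace.bergmanDilation_apply (h : BlochSpace) {r : ℝ} (hr0 : 0 ≤ r) (hr1 : r < 1) {z : ℂ}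
    (hz : z ∈ unitDisk) : h.bergmanDilation hr0 hr1 z = h (r * z) :=
  h.dilation_apply hr0 hr1 hz

lemma BlochSpace.tendsto_dilation (h : BlochSpace) {r : ℕ → ℝ} (hr : Tendsto r atTop (𝓝 1)) {z : ℂ}
    (hz : z ∈ unitDisk) : Tendsto (fun n => h (r n * z)) atTop (𝓝 (h z)) := by
  have h1 : Tendsto (fun n => (r n : ℂ) * z) atTop (𝓝 z) := by
    simpa using ((Complex.continuous_ofReal.tendsto 1).comp hr).mul_const z
  exact (diskAnalytic.differentiableAt h.mem_analytic hz).continuousAt.tendsto.comp h1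

lemma BlochSpace.eq_zero_of_integral (h : BlochSpace)
    (hi : Integrable (fun z => ‖h z‖ ^ 2 * (1 - ‖z‖ ^ 2)) diskMeasure)
    (h0 : ∫ z, ‖h z‖ ^ 2 * (1 - ‖z‖ ^ 2) ∂diskMeasure = 0) : h = 0 := by
  have hnn : 0 ≤ᵐ[diskMeasure] fun z => ‖h z‖ ^ 2 * (1 - ‖z‖ ^ 2) := by
    filter_upwards [ae_mem_unitDisk] with z hz
    exact mul_nonneg (sq_nonneg _) (weight_pos hz).le
  have h1 := (integral_eq_zero_iff_of_nonneg_ae hnn hi).1 h0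
  have h2 : ∀ᵐ z ∂volume.restrict unitDisk, ‖h z‖ ^ 2 * (1 - ‖z‖ ^ 2) = 0 :=
    (Measure.ae_ennreal_smul_measure_iff (by simp [Real.pi_pos])).1 h1
  have h3 : (fun z => h z) =ᵐ[volume.restrict unitDisk] fun _ => 0 := by
    filter_upwards [h2, ae_restrict_mem measurableSet_ball] with z hz hzd
    simpa [(weight_pos hzd).ne'] using hz
  exact BlochSpace.ext_disk (Measure.eqOn_open_of_ae_eq h3 Metric.isOpen_ball
    h.mem_analytic.1.continuousOn continuousOn_const)

/-- The dilations of `h` are bounded, hence admissible test functions for `R₂(h) = 0`. Letting the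
radius tend to 1 gives `∫ |h|² (1 - |z|²) dm = 0`. -/
lemma blochR2_injective : Function.Injective blochR2 := by
  refine (injective_iff_map_eq_zero blochR2).2 fun h hh => ?_
  obtain ⟨K, hK⟩ := h.exists_growth_sqrt
  obtain ⟨r, -, hr, hr1⟩ := exists_seq_strictMono_tendsto' (zero_lt_one (α := ℝ))
  -- Each factor costs `(1 - |z|)^(-1/2)`, and `1 - |z|² ≤ 2(1 - |z|)` pays for both. The case `s <
  -- 1` gives the dominating constant, the case `s = 1` the integrability of the limit.
  have hbound : ∀ {s : ℝ}, 0 ≤ s → s ≤ 1 → ∀ z ∈ unitDisk,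
      ‖h (s * z)‖ * ‖h z‖ * (1 - ‖z‖ ^ 2) ≤ 2 * K ^ 2 := fun {s} hs0 hs1 z hz => by
    have hz1 : ‖z‖ < 1 := by simpa using hz
    have h1 := hK _ (mul_mem_unitDisk hs0 hs1 hz)
    have h2 := hK z hz
    have h3 : √(1 - ‖z‖) ≤ √(1 - ‖(s : ℂ) * z‖) := by
      refine Real.sqrt_le_sqrt ?_
      rw [norm_mul, Complex.norm_real, Real.norm_of_nonneg hs0]
      nlinarith [norm_nonneg z]
    have h4 : ‖h (s * z)‖ * √(1 - ‖z‖) ≤ K := le_trans (by gcongr) h1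
    have h5 : √(1 - ‖z‖) * √(1 - ‖z‖) = 1 - ‖z‖ := Real.mul_self_sqrt (by linarith)
    have h6 := mul_le_mul h4 h2 (by positivity) (le_trans (by positivity) h4)
    calc ‖h (s * z)‖ * ‖h z‖ * (1 - ‖z‖ ^ 2)
        = (‖h (s * z)‖ * √(1 - ‖z‖)) * (‖h z‖ * √(1 - ‖z‖)) * (1 + ‖z‖) := by
          linear_combination -(‖h (s * z)‖ * ‖h z‖ * (1 + ‖z‖)) * h5
      _ ≤ K * K * 2 := mul_le_mul h6 (by linarith) (by positivity) (mul_self_nonneg K)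
      _ = _ := by ring
  have hlim : Tendsto (fun n => weightedPairing (h.bergmanDilation (hr n).1.le (hr n).2) h) atTop
      (𝓝 (weightedPairing h h)) := by
    refine tendsto_integral_of_dominated_convergence (fun _ => 2 * K ^ 2)
      (fun n => (integrable_pairing' _ h).aestronglyMeasurable) (integrable_const _)
      (fun n => ?_) ?_
    · filter_upwards [ae_mem_unitDisk] with z hz
      rw [norm_mul, norm_mul, RCLike.norm_conj, Complex.norm_real,
        Real.norm_of_nonneg (weight_pos hz).le, h.bergmanDilation_apply _ _ hz]
      exact hbound (hr n).1.le (hr n).2.le z hz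
    · filter_upwards [ae_mem_unitDisk] with z hz
      refine ((Tendsto.mul_const _ ?_).mul_const _)
      refine (h.tendsto_dilation hr1 hz).congr fun n => ?_
      rw [h.bergmanDilation_apply _ _ hz]
  have hzero : ∀ n, weightedPairing (h.bergmanDilation (hr n).1.le (hr n).2) h = 0 := fun n => by
    rw [← blochR2_apply, hh, zero_apply]
  simp only [hzero] at hlim
  have h0 : weightedPairing h h = 0 := (tendsto_nhds_unique hlim tendsto_const_nhds)
  have h1 : weightedPairing h h = ((∫ z, ‖h z‖ ^ 2 * (1 - ‖z‖ ^ 2) ∂diskMeasure : ℝ) : ℂ) := by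
    rw [weightedPairing, ← integral_complex_ofReal]
    refine integral_congr_ae (Eventually.of_forall fun z => ?_)
    simp only [Complex.mul_conj']
    push_cast
    rfl
  refine h.eq_zero_of_integral ?_ (by rw [h0] at h1; exact_mod_cast h1.symm)
  refine Integrable.of_bound ?_ (2 * K ^ 2) ?_
  · exact ((aestronglyMeasurable_of_analytic h.mem_analytic).norm.pow 2).mul
      (Continuous.aestronglyMeasurable (by fun_prop))
  · filter_upwards [ae_mem_unitDisk] with z hz
    rw [Real.norm_of_nonneg (mul_nonneg (sq_nonneg _) (weight_pos hz).le)]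
    simpa [sq] using hbound zero_le_one le_rfl z hz

/-! ### Surjectivity by weak* compactness. -/

/-- Every Bloch function comes from the bidual of the little Bloch space, with control of norms. -/
lemma exists_bidualToBloch_eq (h : BlochSpace) :
    ∃ F : StrongDual ℂ (StrongDual ℂ LittleBloch), ‖F‖ ≤ ‖h‖ ∧ bidualToBloch F = h := by
  obtain ⟨r, -, hr, hr1⟩ := exists_seq_strictMono_tendsto' (zero_lt_one (α := ℝ))
  let Φ : ℕ → WeakDual ℂ (StrongDual ℂ LittleBloch) := fun n => StrongDual.toWeakDual
    (NormedSpace.inclusionInDoubleDual ℂ LittleBloch (h.dilation (hr n).1.le (hr n).2))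
  -- Banach–Alaoglu supplies a cluster point. No convergent subsequence is needed: on each `δ_z` the
  -- sequence already converges to `h z`, which forces the value of the cluster point there.
  obtain ⟨x, hx, hcl⟩ := (WeakDual.isCompact_closedBall (𝕜 := ℂ)
    (0 : StrongDual ℂ (StrongDual ℂ LittleBloch)) ‖h‖).exists_mapClusterPt (f := atTop) (u := Φ)
    (by
      refine le_principal_iff.2 (mem_map.2 (Eventually.of_forall fun n => ?_))
      exact mem_closedBall_zero_iff.2
        ((NormedSpace.double_dual_bound ℂ LittleBloch _).trans (h.norm_dilation_le _ _)))
  refine ⟨WeakDual.toStrongDual x, by simpa using hx, BlochSpace.ext_disk fun z hz => ?_⟩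
  have h1 : MapClusterPt (x (pointEval z)) atTop (fun n => Φ n (pointEval z)) :=
    hcl.continuousAt_comp (WeakDual.eval_continuous (pointEval z)).continuousAt
  have h2 : Tendsto (fun n => Φ n (pointEval z)) atTop (𝓝 (h z)) :=
    (h.tendsto_dilation hr1 hz).congr fun n =>
      (h.dilation_apply (hr n).1.le (hr n).2 hz).symm
  have h3 : ClusterPt (x (pointEval z)) (𝓝 (h z)) := h1.clusterPt.mono h2
  have h4 : (𝓝 (x (pointEval z)) ⊓ 𝓝 (h z)).NeBot := h3
  exact eq_of_nhds_neBot h4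

/-! ### Functionals on `B₀` are determined up to small norm inside the disk. -/

/-- Rotating `b` to the argument of `a`. It lets the values of a functional on two functions add up
without cancellation. -/
lemma Complex.exists_norm_add_mul_eq (a b : ℂ) :
    ∃ u : ℂ, ‖u‖ = 1 ∧ ‖a + u * b‖ = ‖a‖ + ‖b‖ := by
  refine ⟨Complex.exp ((a.arg - b.arg : ℝ) * Complex.I), Complex.norm_exp_ofReal_mul_I _, ?_⟩
  have h : a + Complex.exp ((a.arg - b.arg : ℝ) * Complex.I) * b =
      ((‖a‖ + ‖b‖ : ℝ) : ℂ) * Complex.exp (a.arg * Complex.I) := by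
    have h1 : Complex.exp (a.arg * Complex.I) = Complex.exp ((a.arg - b.arg : ℝ) * Complex.I) *
        Complex.exp (b.arg * Complex.I) := by
      rw [← Complex.exp_add]; congr 1; push_cast; ring
    have ha := Complex.norm_mul_exp_arg_mul_I a
    have hb := Complex.norm_mul_exp_arg_mul_I b
    push_cast at h1 ⊢
    linear_combination -ha - Complex.exp ((a.arg - b.arg) * Complex.I) * hb - ‖b‖ * h1
  rw [h, norm_mul, Complex.norm_exp_ofReal_mul_I, mul_one, Complex.norm_real,
    Real.norm_of_nonneg (by positivity)]

lemma BlochSpace.deriv_add_smul (f g : BlochSpace) (c : ℂ) {z : ℂ} (hz : z ∈ unitDisk) :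
    deriv (f + c • g : BlochSpace) z = deriv f z + c * deriv g z := by
  rw [BlochSpace.coe_add, diskAnalytic.deriv_add f.mem_analytic (c • g).mem_analytic hz,
    BlochSpace.coe_smul, diskAnalytic.deriv_smul g.mem_analytic c hz]

lemma BlochSpace.norm_eq_seminorm {f : BlochSpace} (h : f 0 = 0) : ‖f‖ = f.seminorm := by
  rw [BlochSpace.norm_def, h, norm_zero, zero_add]

/-- A functional on the little Bloch space is small on the functions in the unit ball that vanish
at `0` and whose weighted derivative is small on a large compact part of the disk. -/
lemma LittleBloch.exists_norm_apply_le (φ : StrongDual ℂ LittleBloch) {ε : ℝ} (hε : 0 < ε) :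
    ∃ ρ η : ℝ, 0 ≤ ρ ∧ ρ < 1 ∧ 0 < η ∧ ∀ g : LittleBloch, (g : BlochSpace) 0 = 0 →
      (g : BlochSpace).seminorm ≤ 1 →
      (∀ z, ‖z‖ ≤ ρ → (1 - ‖z‖ ^ 2) * ‖deriv (g : BlochSpace) z‖ ≤ η) → ‖φ g‖ ≤ ε := by
  -- On functions vanishing at 0 the norm is the seminorm, a pure supremum over the disk, so it can
  -- be estimated separately on the two regions below.
  let V : Submodule ℂ LittleBloch := LinearMap.ker (pointEval 0).toLinearMap
  let ψ : StrongDual ℂ V := φ.comp V.subtypeL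
  have hψ : ∀ x : LittleBloch, (x : BlochSpace) 0 = 0 → ‖φ x‖ ≤ ‖ψ‖ * ‖x‖ :=
    fun x hx => ψ.le_opNorm ⟨x, hx⟩
  obtain ⟨⟨f, hf0⟩, hf1, hfφ⟩ := ψ.exists_lt_apply_of_lt_opNorm (sub_lt_self ‖ψ‖ (half_pos hε))
  replace hf0 : (f : BlochSpace) 0 = 0 := hf0
  replace hf1 : ‖f‖ < 1 := hf1
  replace hfφ : ‖ψ‖ - ε / 2 < ‖φ f‖ := hfφ
  have hfs : (f : BlochSpace).seminorm ≤ 1 :=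
    (f : BlochSpace).seminorm_le_norm.trans (by rw [norm_coe]; exact hf1.le)
  -- The final inequality is `‖φ f‖ + ‖φ g‖ ≤ ‖ψ‖(1 + η)` with `‖φ f‖ > ‖ψ‖ - ε/2`, so `η‖ψ‖ ≤ ε/2`
  -- is what is needed; the `+ 1` covers `ψ = 0`.
  obtain ⟨η, hη, hηε⟩ : ∃ η : ℝ, 0 < η ∧ η * ‖ψ‖ ≤ ε / 2 := by
    refine ⟨ε / 2 / (‖ψ‖ + 1), by positivity, ?_⟩
    rw [div_mul_eq_mul_div, div_le_iff₀ (by positivity)]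
    nlinarith [norm_nonneg ψ]
  obtain ⟨ρ, hρ0, hρ1, hρ⟩ : ∃ ρ : ℝ, 0 ≤ ρ ∧ ρ < 1 ∧ ∀ z : ℂ, ρ < ‖z‖ → z ∈ unitDisk →
      (1 - ‖z‖ ^ 2) * ‖deriv (f : BlochSpace) z‖ ≤ η := by
    have h := f.tendsto.eventually (Iio_mem_nhds hη)
    rw [eventually_comap] at h
    obtain ⟨a, ha, h⟩ := (mem_nhdsLT_iff_exists_Ioo_subset' (zero_lt_one (α := ℝ))).1 h
    refine ⟨max a 0, le_max_right _ _, max_lt ha zero_lt_one, fun z hz hzd => ?_⟩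
    exact (h ⟨(le_max_left _ _).trans_lt hz, by simpa using hzd⟩ z rfl).le
  refine ⟨ρ, η, hρ0, hρ1, hη, fun g hg0 hgs hg => ?_⟩
  obtain ⟨u, hu, hu'⟩ := Complex.exists_norm_add_mul_eq (φ f) (φ g)
  have h0 : ((f + u • g : LittleBloch) : BlochSpace) 0 = 0 := by
    change (f : BlochSpace) 0 + u * (g : BlochSpace) 0 = 0
    rw [hf0, hg0, mul_zero, add_zero]
  -- For `|z| ≤ ρ` the function `f` contributes at most 1 and `g` at most `η`; for `|z| > ρ` the
  -- roles are exchanged, by the decay of `f` at the boundary.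
  have h1 : ‖f + u • g‖ ≤ 1 + η := by
    rw [← norm_coe, BlochSpace.norm_eq_seminorm h0]
    refine ciSup_le fun z => ?_
    rw [coe_add, coe_smul, BlochSpace.deriv_add_smul _ _ _ z.2]
    have hw := weight_pos z.2
    have hd : ‖deriv (f : BlochSpace) z + u * deriv (g : BlochSpace) z‖ ≤
        ‖deriv (f : BlochSpace) z‖ + ‖deriv (g : BlochSpace) z‖ := by
      simpa [hu] using norm_add_le (deriv (f : BlochSpace) z) (u * deriv (g : BlochSpace) z)
    have hfz := ((f : BlochSpace).le_seminorm z.2).trans hfs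
    have hgz := ((g : BlochSpace).le_seminorm z.2).trans hgs
    rcases le_or_gt ‖(z : ℂ)‖ ρ with hz | hz
    · have := hg z hz
      nlinarith
    · have := hρ z hz z.2
      nlinarith
  have h2 := hψ _ h0
  rw [map_add, map_smul, smul_eq_mul, hu'] at h2
  nlinarith [norm_nonneg ψ]

/-- The difference of `f` and its dilation vanishes at 0, has seminorm at most `2‖f‖`, and has small
derivative on a compact disk uniformly for `f` in the unit ball. Divided by `2‖f‖`, it falls under
`exists_norm_apply_le`. -/
lemma LittleBloch.exists_dilation_close (φ : StrongDual ℂ LittleBloch) {ε : ℝ} (hε : 0 < ε) :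
    ∃ (r : ℝ) (hr0 : 0 ≤ r) (hr1 : r < 1), ∀ f : LittleBloch,
      ‖φ (f - (f : BlochSpace).dilation hr0 hr1)‖ ≤ ε * ‖f‖ := by
  obtain ⟨ρ, η, hρ0, hρ1, hη, H⟩ := exists_norm_apply_le φ (half_pos hε)
  -- The gap between `ρ` and `σ` is the room for Cauchy's estimate.
  set σ : ℝ := (1 + ρ) / 2 with hσ
  have hσ1 : σ < 1 := by linarith
  have hσρ : 0 < σ - ρ := by linarith
  have hwσ : 0 < 1 - σ ^ 2 := by nlinarith
  -- On `|w| ≤ σ` the difference is at most `‖f‖(1 - r)/(1 - σ²)`, so Cauchy's estimate bounds its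
  -- derivative by `2‖f‖(1 - r)/((1 - σ²)(σ - ρ))`. This `r` makes that at most `2‖f‖η`; the maximum
  -- only keeps `r` nonnegative.
  have hr1 : max 0 (1 - η * ((1 - σ ^ 2) * (σ - ρ))) < 1 :=
    max_lt zero_lt_one (sub_lt_self _ (by positivity))
  have hr2 : 1 - max 0 (1 - η * ((1 - σ ^ 2) * (σ - ρ))) ≤ η * ((1 - σ ^ 2) * (σ - ρ)) := by
    linarith [le_max_right 0 (1 - η * ((1 - σ ^ 2) * (σ - ρ)))]
  generalize hr : max 0 (1 - η * ((1 - σ ^ 2) * (σ - ρ))) = r at hr1 hr2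
  have hr0 : 0 ≤ r := hr ▸ le_max_left _ _
  refine ⟨r, hr0, hr1, fun f => ?_⟩
  rcases eq_or_ne f 0 with rfl | hf
  · have : (((0 : LittleBloch) : BlochSpace).dilation hr0 hr1) = 0 :=
      LittleBloch.ext_disk fun z hz => by rw [BlochSpace.dilation_apply _ _ _ hz]; rfl
    simp [this]
  have hf' : 0 < ‖f‖ := norm_pos_iff.2 hf
  set d : LittleBloch := f + (-1 : ℂ) • (f : BlochSpace).dilation hr0 hr1 with hd
  have hsd : f - (f : BlochSpace).dilation hr0 hr1 = d := by rw [hd, neg_one_smul, sub_eq_add_neg]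
  have hdz : ∀ z ∈ unitDisk, (d : BlochSpace) z = (f : BlochSpace) z - (f : BlochSpace) (r * z) :=
    fun z hz => by
      change (f : BlochSpace) z + (-1) * ((f : BlochSpace).dilation hr0 hr1 : BlochSpace) z = _
      rw [BlochSpace.dilation_apply _ _ _ hz]; ring
  have hfs := (f : BlochSpace).seminorm_le_norm
  rw [norm_coe] at hfs
  have hds : (d : BlochSpace).seminorm ≤ 2 * ‖f‖ := by
    have h1 := BlochSpace.seminorm_add_le f
      ((-1 : ℂ) • ((f : BlochSpace).dilation hr0 hr1 : BlochSpace))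
    have h2 := BlochSpace.seminorm_smul_le (-1) ((f : BlochSpace).dilation hr0 hr1 : BlochSpace)
    have h3 := (f : BlochSpace).seminorm_dilation_le hr0 hr1
    rw [norm_neg, norm_one, one_mul] at h2
    exact h1.trans (by linarith)
  have hderiv : ∀ z : ℂ, ‖z‖ ≤ ρ → ‖deriv (d : BlochSpace) z‖ ≤ 2 * ‖f‖ * η := fun z hz => by
    have hball : ∀ w ∈ Metric.ball z (σ - ρ), ‖w‖ ≤ σ := fun w hw => by
      have h1 : ‖w - z‖ < σ - ρ := by simpa [dist_eq_norm] using hw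
      linarith [norm_le_norm_add_norm_sub' w z]
    have hle := norm_deriv_le_of_norm_le_ball (g := (d : BlochSpace)) (c := z)
      (M := ‖f‖ / (1 - σ ^ 2) * (1 - r)) hσρ
      ((d : BlochSpace).mem_analytic.1.mono fun w hw => mem_unitDisk_of_norm_le hσ1 (hball w hw))
      fun w hw => by
        have hwσ' := hball w hw
        rw [hdz w (mem_unitDisk_of_norm_le hσ1 hwσ')]
        have hn : ‖(r : ℂ) * w‖ = r * ‖w‖ := by
          rw [norm_mul, Complex.norm_real, Real.norm_of_nonneg hr0]
        have h1 := (f : BlochSpace).norm_sub_le hσ1 hwσ' (w := r * w)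
          (by rw [hn]; nlinarith [norm_nonneg w])
        have h2 : ‖w - r * w‖ ≤ 1 - r := by
          have : w - r * w = ((1 - r : ℝ) : ℂ) * w := by push_cast; ring
          rw [this, norm_mul, Complex.norm_real, Real.norm_of_nonneg (by linarith)]
          exact mul_le_of_le_one_right (by linarith) (hwσ'.trans hσ1.le)
        refine h1.trans ?_
        gcongr
    refine hle.trans ?_
    rw [div_le_iff₀ hσρ, div_mul_eq_mul_div, mul_div_assoc', div_le_iff₀ hwσ]
    nlinarith
  set c : ℂ := (((2 * ‖f‖)⁻¹ : ℝ) : ℂ) with hc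
  have hcn : ‖c‖ = (2 * ‖f‖)⁻¹ := by
    rw [hc, Complex.norm_real, Real.norm_of_nonneg (by positivity)]
  have key := H (c • d) (by
      change c * (d : BlochSpace) 0 = 0
      rw [hdz 0 (by simp)]; simp)
    (by
      refine (BlochSpace.seminorm_smul_le c d).trans ?_
      rw [hcn, inv_mul_le_iff₀ (by positivity), mul_one]
      exact hds)
    (fun z hz => by
      rw [coe_smul, BlochSpace.coe_smul, diskAnalytic.deriv_smul (d : BlochSpace).mem_analytic c
        (mem_unitDisk_of_norm_le hρ1 hz), norm_mul, hcn]
      have h1 := hderiv z hz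
      have h2 : (2 * ‖f‖)⁻¹ * ‖deriv (d : BlochSpace) z‖ ≤ η := by
        rwa [inv_mul_le_iff₀ (by positivity)]
      have h3 := weight_pos (mem_unitDisk_of_norm_le hρ1 hz)
      have h4 : 0 ≤ (2 * ‖f‖)⁻¹ * ‖deriv (d : BlochSpace) z‖ := by positivity
      nlinarith [sq_nonneg ‖z‖])
  rw [map_smul, norm_smul, hcn, inv_mul_le_iff₀ (by positivity)] at key
  rw [hsd]
  linarith

/-- Only values of `g` at distance at least `R - r` from the circle of radius `R` enter, so Cauchy's
estimate applies. It turns uniform closeness on a disk into closeness in the Bloch norm after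
dilation. -/
lemma BlochSpace.norm_le_of_apply_eq {u : BlochSpace} {g : ℂ → ℂ} {r R M : ℝ} (hr0 : 0 ≤ r)
    (hr1 : r ≤ 1) (hrR : r < R) (hg : DifferentiableOn ℂ g (Metric.ball 0 R))
    (hM : ∀ z ∈ Metric.ball 0 R, ‖g z‖ ≤ M) (hu : ∀ z ∈ unitDisk, u z = g (r * z)) :
    ‖u‖ ≤ M * (1 + 2 / (R - r)) := by
  have hR : 0 < R := hr0.trans_lt hrR
  have hM0 : 0 ≤ M := (norm_nonneg _).trans (hM 0 (by simpa using hR))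
  have h0 : ‖u 0‖ ≤ M := by
    rw [hu 0 (by simp), mul_zero]
    exact hM 0 (by simpa using hR)
  have h1 : u.seminorm ≤ 2 * M / (R - r) := ciSup_le fun z => by
    have hz : ‖(z : ℂ)‖ < 1 := mem_ball_zero_iff.1 z.2
    have hn : ‖(r : ℂ) * z‖ ≤ r := by
      rw [norm_mul, Complex.norm_real, Real.norm_of_nonneg hr0]
      exact mul_le_of_le_one_right hr0 hz.le
    have hsub : Metric.ball ((r : ℂ) * z) (R - r) ⊆ Metric.ball 0 R :=
      Metric.ball_subset_ball' (by rw [dist_zero_right]; linarith)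
    have hgd := norm_deriv_le_of_norm_le_ball (sub_pos.2 hrR) (hg.mono hsub)
      fun w hw => hM w (hsub hw)
    have hd : HasDerivAt (fun w : ℂ => g (r * w)) (deriv g (r * z) * r) (z : ℂ) := by
      have h2 := (hg.differentiableAt (Metric.isOpen_ball.mem_nhds
        (show (r : ℂ) * z ∈ Metric.ball 0 R by simpa using hn.trans_lt hrR))).hasDerivAt
      have h3 : HasDerivAt (fun w : ℂ => (r : ℂ) * w) r (z : ℂ) := by
        simpa using (hasDerivAt_id (z : ℂ)).const_mul (r : ℂ)
      exact h2.comp (z : ℂ) h3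
    have heq : deriv u z = deriv g (r * z) * r := by
      rw [← hd.deriv]
      refine Filter.EventuallyEq.deriv_eq ?_
      filter_upwards [Metric.isOpen_ball.mem_nhds z.2] with w hw
      exact hu w hw
    rw [heq, norm_mul, Complex.norm_real, Real.norm_of_nonneg hr0]
    have h4 : ‖deriv g (r * z)‖ * r ≤ ‖deriv g (r * z)‖ :=
      mul_le_of_le_one_right (norm_nonneg _) hr1
    have h5 := weight_pos z.2
    have h6 : 0 ≤ ‖deriv g (r * z)‖ * r := by positivity
    nlinarith [sq_nonneg ‖(z : ℂ)‖]
  rw [BlochSpace.norm_def]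
  calc _ ≤ M + 2 * M / (R - r) := add_le_add h0 h1
    _ = _ := by ring

/-- If `F ∈ B₀**` vanishes on all point evaluations, then its kernel is dense in `B₀*`. -/
lemma exists_bidual_eq_zero_norm_sub_le {F : StrongDual ℂ (StrongDual ℂ LittleBloch)}
    (hF : ∀ z, F (pointEval z) = 0) (φ : StrongDual ℂ LittleBloch) {ε : ℝ} (hε : 0 < ε) :
    ∃ ψ, F ψ = 0 ∧ ‖φ - ψ‖ ≤ ε := by
  obtain ⟨r, hr0, hr1, hr⟩ := LittleBloch.exists_dilation_close φ (half_pos hε)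
  -- Radii `r < S < R < 1`: the Taylor series of `pointEval` lives on radius `R`, converges
  -- uniformly on radius `S`, and the gap `S - r` is spent on Cauchy's estimate.
  obtain ⟨S, hrS, hS1⟩ := exists_between hr1
  obtain ⟨R, hSR, hR1⟩ := exists_between hS1
  have hS0 : 0 < S := hr0.trans_lt hrS
  lift S to NNReal using hS0.le
  lift R to NNReal using (hS0.trans hSR).le
  have hp := hasFPowerSeriesOnBall_pointEval (R := R) (by exact_mod_cast hS0.trans hSR)
    (by exact_mod_cast hR1)
  set p := cauchyPowerSeries pointEval 0 R with hpdef
  -- Applying `F` to the series of `pointEval` gives a power series of the zero function, whose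
  -- coefficients vanish.
  have hFp : ∀ n, F (p.coeff n) = 0 := fun n => by
    have h1 := (F.comp_hasFPowerSeriesOnBall hp).hasFPowerSeriesAt
    rw [show ⇑F ∘ pointEval = 0 from funext hF] at h1
    have h2 := congrArg (fun q : FormalMultilinearSeries ℂ ℂ ℂ => q n 1) h1.eq_zero
    exact h2
  obtain ⟨δ, hδ, hδε⟩ : ∃ δ : ℝ, 0 < δ ∧ ‖φ‖ * (δ * (1 + 2 / (S - r))) ≤ ε / 2 := by
    have hK : 0 < 1 + 2 / ((S : ℝ) - r) := by
      have := sub_pos.2 hrS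
      positivity
    refine ⟨ε / 2 / ((‖φ‖ + 1) * (1 + 2 / (S - r))), by positivity, ?_⟩
    rw [div_mul_eq_mul_div, mul_div_assoc', div_le_iff₀ (by positivity)]
    nlinarith [norm_nonneg φ, mul_pos (half_pos hε) hK]
  obtain ⟨N, hN⟩ := (Metric.tendstoUniformlyOn_iff.1
    (hp.tendstoUniformlyOn (r' := S) (by exact_mod_cast hSR)) δ hδ).exists
  have hN' : ∀ z ∈ Metric.ball (0 : ℂ) S,
      ‖pointEval z - ∑ k ∈ Finset.range N, z ^ k • p.coeff k‖ ≤ δ := fun z hz => by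
    have h := hN z hz
    rw [dist_eq_norm, zero_add, FormalMultilinearSeries.partialSum] at h
    simpa only [FormalMultilinearSeries.apply_eq_pow_smul_coeff] using h.le
  -- This functional sends `f` to the value of `φ` on the Taylor polynomial, with terms of degree
  -- below `N`, of the dilation of `f`.
  refine ⟨∑ k ∈ Finset.range N, ((r : ℂ) ^ k * φ (monomial k)) • p.coeff k, ?_, ?_⟩
  · rw [map_sum]
    exact Finset.sum_eq_zero fun k _ => by rw [map_smul, hFp, smul_zero]
  refine ContinuousLinearMap.opNorm_le_bound _ hε.le fun f => ?_
  set D := (f : BlochSpace).dilation hr0 hr1 with hD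
  set P : LittleBloch := ∑ k ∈ Finset.range N, ((r : ℂ) ^ k * p.coeff k f) • monomial k with hP
  have hφP : (∑ k ∈ Finset.range N, ((r : ℂ) ^ k * φ (monomial k)) • p.coeff k) f = φ P := by
    rw [hP, map_sum, sum_apply]
    refine Finset.sum_congr rfl fun k _ => ?_
    rw [map_smul, smul_apply, smul_eq_mul, smul_eq_mul]
    ring
  have hDP : ‖D - P‖ ≤ δ * ‖f‖ * (1 + 2 / (S - r)) := by
    rw [← norm_coe]
    refine BlochSpace.norm_le_of_apply_eq
      (g := fun z => (f : BlochSpace) z - ∑ k ∈ Finset.range N, z ^ k * p.coeff k f)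
      hr0 hr1.le hrS ?_ ?_ ?_
    · refine DifferentiableOn.sub ((f : BlochSpace).mem_analytic.1.mono
        (Metric.ball_subset_ball hS1.le)) ?_
      fun_prop
    · intro z hz
      have h1 := ContinuousLinearMap.le_of_opNorm_le _ (hN' z hz) f
      simpa [pointEval_apply] using h1
    · intro z hz
      have h1 : ((D - P : LittleBloch) : BlochSpace) z = pointEval z D - pointEval z P := by
        rw [← map_sub]; rfl
      rw [h1, hP, map_sum, pointEval_apply, hD, BlochSpace.dilation_apply _ _ _ hz]
      congr 1
      refine Finset.sum_congr rfl fun k _ => ?_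
      rw [map_smul, pointEval_apply, monomial_apply k hz, smul_eq_mul, mul_pow]
      ring
  have h1 : (φ - ∑ k ∈ Finset.range N, ((r : ℂ) ^ k * φ (monomial k)) • p.coeff k) f =
      φ (f - D) + φ (D - P) := by
    rw [sub_apply, hφP, map_sub, map_sub]
    ring
  rw [h1]
  calc ‖φ (f - D) + φ (D - P)‖ ≤ ε / 2 * ‖f‖ + ‖φ‖ * (δ * ‖f‖ * (1 + 2 / (S - r))) :=
        (norm_add_le _ _).trans (add_le_add (hr f) (φ.le_opNorm_of_le hDP))
    _ = ε / 2 * ‖f‖ + ‖φ‖ * (δ * (1 + 2 / (S - r))) * ‖f‖ := by ring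
    _ ≤ ε / 2 * ‖f‖ + ε / 2 * ‖f‖ := by gcongr
    _ = ε * ‖f‖ := by ring

lemma bidual_eq_zero_of_pointEval {F : StrongDual ℂ (StrongDual ℂ LittleBloch)}
    (hF : ∀ z, F (pointEval z) = 0) : F = 0 := by
  refine ContinuousLinearMap.ext fun φ => norm_le_zero_iff.1 (le_of_forall_pos_le_add
    fun ε hε => ?_)
  obtain ⟨ψ, hψ, hle⟩ := exists_bidual_eq_zero_norm_sub_le hF φ
    (show 0 < ε / (‖F‖ + 1) by positivity)
  have h1 := F.le_opNorm_of_le hle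
  rw [map_sub, hψ, sub_zero] at h1
  refine h1.trans ?_
  rw [zero_add, mul_div_assoc', div_le_iff₀ (by positivity)]
  nlinarith [norm_nonneg F]

/-! ### The isomorphism and the theorem. -/

lemma bidualToBloch_injective : Function.Injective bidualToBloch := fun F G h =>
  sub_eq_zero.1 (bidual_eq_zero_of_pointEval fun z =>
    sub_eq_zero.2 (DFunLike.congr_fun h z : F (pointEval z) = G (pointEval z)))

/-- The linear bijection `B₀** ≃ B`, `F ↦ (z ↦ F(δ_z))`. -/
noncomputable def bidualLinearEquivBloch :
    StrongDual ℂ (StrongDual ℂ LittleBloch) ≃ₗ[ℂ] BlochSpace :=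
  LinearEquiv.ofBijective bidualToBloch ⟨bidualToBloch_injective, fun h =>
    (exists_bidualToBloch_eq h).imp fun _ hF => hF.2⟩

/-- By injectivity the unique preimage is the one found by weak* compactness, so its norm bound
carries over. -/
lemma norm_bidualLinearEquivBloch_symm_le (h : BlochSpace) :
    ‖bidualLinearEquivBloch.symm h‖ ≤ 1 * ‖h‖ := by
  obtain ⟨F, hF, hFh⟩ := exists_bidualToBloch_eq h
  have h1 : bidualLinearEquivBloch.symm h = F := (LinearEquiv.symm_apply_eq _).2 hFh.symm
  rwa [h1, one_mul]

/-- The isomorphism of normed spaces `B₀** ≃ B`, `F ↦ (z ↦ F(δ_z))`. -/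
noncomputable def bidualEquivBloch : StrongDual ℂ (StrongDual ℂ LittleBloch) ≃L[ℂ] BlochSpace :=
  LinearEquiv.toContinuousLinearEquivOfBounds (E := StrongDual ℂ (StrongDual ℂ LittleBloch))
    (F := BlochSpace) (σ := RingHom.id ℂ) (σ₂₁ := RingHom.id ℂ) bidualLinearEquivBloch 2 1
    norm_bidualToBloch_le norm_bidualLinearEquivBloch_symm_le

lemma bidualEquivBloch_apply (F : StrongDual ℂ (StrongDual ℂ LittleBloch)) :
    bidualEquivBloch F = bidualToBloch F := rfl

theorem mainTheorem5 :
    Function.Injective blochR2 ∧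
    Set.range (antiAdjoint (X := BergmanSpace) (Y := StrongDual ℂ LittleBloch) blochR1) ⊆
      Set.range blochR2 ∧
    ∃ R : StrongDual ℂ (StrongDual ℂ LittleBloch) ≃L[ℂ] BlochSpace,
      (∀ F, R F = blochR F) ∧
      (∀ f : LittleBloch, R (NormedSpace.inclusionInDoubleDual ℂ LittleBloch f) = f) ∧
      ∀ (z : ℕ → ℂ) (hz : ∀ n, z n ∈ unitDisk) (hlim : Tendsto (fun n => ‖z n‖) atTop (𝓝 1))
        (F : StrongDual ℂ (StrongDual ℂ LittleBloch)),
        c0Bidual (banachAdjoint (banachAdjoint (interpT z hz hlim)) F) = interpL z hz (R F) := by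
  refine ⟨blochR2_injective, ?_, bidualEquivBloch, fun F => ?_, bidualToBloch_inclusion,
    fun z hz hlim F => ?_⟩
  · rintro _ ⟨F, rfl⟩
    exact ⟨bidualToBloch F, blochR2_bidualToBloch F⟩
  · rw [bidualEquivBloch_apply, blochR, ← blochR2_bidualToBloch,
      Function.leftInverse_invFun blochR2_injective]
  · ext n
    rw [interpL_apply, bidualEquivBloch_apply, deriv_bidualToBloch F (hz n), c0Bidual_apply,
      ← smul_eq_mul, ← map_smul]
    -- It remains to compare two functionals on `B₀`: the `n`-th coordinate composed with `T`, and
    -- the weighted derivative of `pointEval` at `z n`.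
    change F _ = F _
    congr 1
    refine ContinuousLinearMap.ext fun f => ?_
    rw [smul_apply, deriv_pointEval_apply (hz n)]
    rfl
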